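/- **Setting.** Let $F_1,\dots,F_K$ be 1-sub-Gaussian probability distributions with finite first moment on a set $\Omega\subseteq\mathbb R_+$ (that is, $\mathbb E\,e^{\lambda (X-\mathbb EX)}\le e^{\lambda^2/2}$ for all $\lambda$), let $h:[0,1]\to[0,1]$ with $h(0)=0$, and for a distribution with CDF $G$ on $\Omega$ let $$U_h(G)=\int_{-\infty}^0\big(h(1-G(x))-h(1)\big)\,dx+\int_0^\infty h(1-G(x))\,dx .$$ Put $V(a)=U_h(\sum_i a(i)F_i)$ for $a$ in the simplex $\Delta^{K-1}$, let $\alpha^\star$ maximize $V$ on $\Delta^{K-1}$ and let $\Xi$ be the convex hull of the arms. Write $\|\cdot\|_{\rm W}$ for the 1-Wasserstein distance. Assume, for some $B,L>0$, $q\in(0,1]$, $r>0$: $U_h\le B$ on $\Xi$; $U_h$ is finite on distributions on $\Omega$ with finite first moment; $|U_h(G_1)-U_h(G_2)|\le L\|G_1-G_2\|_{\rm W}^q$ for all $G_1\in\Xi$ and all distributions $G_2$ on $\Omega$ with finite first moment; and $U_h(\sum_i\alpha^\star(i)F_i)-U_h(G)\le L\|\sum_i\alpha^\star(i)F_i-G\|_{\rm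 W}^r$ for all $G\in\Xi$. Let $W$ bound the ratios $\|\sum_i a(i)F_i-\sum_i b(i)F_i\|_{\rm W}/\|a-b\|_1$, $a\ne b$ in $\Delta^{K-1}$. **Discretization.** For $\varepsilon>0$ let $\Delta_\varepsilon^{K-1}$ be the set of $a\in\Delta^{K-1}$ with $a(i)=\varepsilon(n_i+\tfrac12)$, $n_i\in\{0,1,\dots\}$, for $i<K$, and $a(K)\ge\varepsilon/2$ (the last coordinate takes up the deficit or excess). Let $a^\star$ maximize $V$ on $\Delta_\varepsilon^{K-1}$, let $\Delta_{\min}(\varepsilon)=\min_{a\in\Delta_\varepsilon^{K-1},\,a\ne a^\star}\{V(a^\star)-V(a)\}$, and $\beta=\lim_{\varepsilon\to0^+}\log\Delta_{\min}(\varepsilon)/\log\varepsilon$. **Algorithms.** Fix a horizon $T$ and $\rho\in(0,1)$. Let $\tau_t(i)$ be the number of pulls of arm $i$ in the first $t$ rounds, $\widehat F_{i,t}$ its empirical distribution, and $R_t(i)=16(\sqrt{2e\log T}+32)/\sqrt{\tau_t(i)}$. Each arm is first pulled $N=\lceil\rho T\varepsilon/4\rceil$ times. For $KN\le t<T$, a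 vector $a_t\in\Delta_\varepsilon^{K-1}$ maximizing an index is computed, where $a_{t-1}$ is kept if it is still a maximizer, and other ties are broken arbitrarily; then $A_{t+1}\in\arg\max_i\{t\,a_t(i)-\tau_t(i)\}$ is pulled. The index of $a$ is, for RS-UCB-M, $\sup U_h(\sum_i a(i)\eta_i)$ over all distributions $\eta_i$ on $\Omega$ with finite first moment and $\|\widehat F_{i,t}-\eta_i\|_{\rm W}\le R_t(i)$ for all $i$; and for CE-UCB-M, $U_h(\sum_i a(i)\widehat F_{i,t})+L\sum_i (a(i)R_t(i))^q$. The regret is $\mathfrak R(T)=V(\alpha^\star)-\mathbb E[V(\tau_T/T)]$. **Theorem 4.** Suppose that $\beta$ exists and $r\le\beta+\frac q2$. Put $\kappa=(\frac{2\beta}q+2)^{-1}$ and $c_{\rm U}=\max\{r(1+\frac{2\kappa}q),1-\kappa\}$. Let $T_0(\varepsilon)$ be the least $t\ge1$ such that $$\frac{\sqrt{2e\log s}+32}{\sqrt{\rho s\varepsilon/4}}\le\frac1{16}\Big(\frac{\Delta_{\min}(\varepsilon)}{2KL}\Big)^{1/q}\quad\text{for all integers } s\ge t,$$ and $T(\varepsilon)=\frac2\varepsilon(T_0(\varepsilon)-1)$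 (both are $\infty$ if there is no such $t$). 1. For all $0<c_1\le c_2$ there is a constant $C$, depending only on $q,r,\beta,\rho,B,L,W,c_1,c_2$ (not on $K$, $T$ or the instance otherwise), such that, if $x=(K^{2/q}\frac{\log T}T)^\kappa$, $c_1x\le\varepsilon\le c_2x$ and $T>\max\{e^K,T(\varepsilon)\}$, then both RS-UCB-M and CE-UCB-M satisfy $$\mathfrak R(T)\le C\,K^{c_{\rm U}}\Big(\frac{\log T}T\Big)^{r\kappa}.$$ 2. This choice of $\varepsilon$ is feasible: for every $c_0>0$ there is a $c>0$, depending only on $c_0$ and $q,r,\beta,\rho,B,L,W$, such that, if $\Delta_{\min}(\varepsilon)\ge c_0\varepsilon^\beta$ for all small $\varepsilon>0$, then for every $c_2$ and all sufficiently large $T$, every $\varepsilon$ with $cx\le\varepsilon\le c_2x$ satisfies $T>\max\{e^K,T(\varepsilon)\}$. -/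

import Mathlib

open MeasureTheory ProbabilityTheory Filter Topology
open scoped ENNReal

noncomputable section

namespace MixtureBandit

/-! ### Distributions on the line, distortion riskmetrics, mixtures -/

/-- The cumulative distribution function `x ↦ μ((-∞, x])`. -/
def distFun (μ : Measure ℝ) (x : ℝ) : ℝ := μ.real (Set.Iic x)

/-- Probability measures carried by `S` with a finite first moment. -/
def P1 (S : Set ℝ) : Set (Measure ℝ) :=
  {μ | IsProbabilityMeasure μ ∧ μ Sᶜ = 0 ∧ Integrable (fun x : ℝ => x) μ}

/-- The 1-Wasserstein distance of two distributions on the line with finite first moments,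
as the area between the two distribution functions. -/
def wasserstein (μ ν : Measure ℝ) : ℝ := ∫ x, |distFun μ x - distFun ν x|

/-- The distortion riskmetric with distortion function `h` (a signed Choquet integral).
Only the values of `h` on `[0,1]` enter. -/
def riskmetric (h : ℝ → ℝ) (μ : Measure ℝ) : ℝ :=
  (∫ x in Set.Iio (0 : ℝ), (h (1 - distFun μ x) - h 1)) +
    ∫ x in Set.Ioi (0 : ℝ), h (1 - distFun μ x)

/-- The mixture `∑ i, a(i) F_i`. -/
def mixture {K : ℕ} (a : Fin K → ℝ) (F : Fin K → Measure ℝ) : Measure ℝ :=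
  ∑ i, ENNReal.ofReal (a i) • F i

/-- `V(a, F)`: the riskmetric of the mixture with coefficients `a`. -/
def mixValue {K : ℕ} (h : ℝ → ℝ) (F : Fin K → Measure ℝ) (a : Fin K → ℝ) : ℝ :=
  riskmetric h (mixture a F)

/-- The convex hull `Ξ` of the arm distributions. -/
def hull {K : ℕ} (F : Fin K → Measure ℝ) : Set (Measure ℝ) :=
  {G | ∃ a ∈ stdSimplex ℝ (Fin K), G = mixture a F}

/-- The constant `W`: the largest ratio between the 1-Wasserstein distance of two mixtures of the
arms and the `ℓ¹` distance of their coefficients. -/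
def mixRatio {K : ℕ} (F : Fin K → Measure ℝ) : ℝ :=
  sSup {w | ∃ a ∈ stdSimplex ℝ (Fin K), ∃ b ∈ stdSimplex ℝ (Fin K), a ≠ b ∧
    w = wasserstein (mixture a F) (mixture b F) / ∑ i, |a i - b i|}

/-! ### Bandit instances -/

/-- The set of maximizers of `f` on `S`. -/
def argmaxOn {α : Type*} (S : Set α) (f : α → ℝ) : Set α :=
  {x | x ∈ S ∧ ∀ y ∈ S, f y ≤ f x}

/-- The assumptions on an instance: `S ⊆ ℝ₊` is the set of possible rewards, `F` the arms, `h` the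
distortion function, `α` the optimal mixing coefficients of the oracle, `q` and `r` the Hölder and
mixture Hölder exponents with common constant `L`, `B` the bound on the riskmetric, `W` a bound on
the Wasserstein constant of the arms. -/
structure IsInstance {K : ℕ} (S : Set ℝ) (F : Fin K → Measure ℝ) (h : ℝ → ℝ) (α : Fin K → ℝ)
    (q r B L W : ℝ) : Prop where
  measurableSet : MeasurableSet S
  nonneg : S ⊆ Set.Ici 0
  arm_mem : ∀ i, F i ∈ P1 S
  /-- The arms are 1-sub-Gaussian. -/
  subGaussian : ∀ i, HasSubgaussianMGF (fun x => x - ∫ y, y ∂(F i)) 1 (F i)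
  distortion_zero : h 0 = 0
  distortion_mem : ∀ u ∈ Set.Icc (0 : ℝ) 1, h u ∈ Set.Icc (0 : ℝ) 1
  optimal : α ∈ argmaxOn (stdSimplex ℝ (Fin K)) (mixValue h F)
  bounded : ∀ G ∈ hull F, riskmetric h G ≤ B
  /-- The riskmetric is finite (rewards are nonnegative, so only this integral matters). -/
  finite : ∀ G ∈ P1 S, IntegrableOn (fun x => h (1 - distFun G x)) (Set.Ioi 0)
  /-- Hölder continuity with exponent `q`, between mixtures of the arms and distributions on `S`
  (the algorithms evaluate the riskmetric at estimates of the arms, which need not be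
  in the hull). -/
  holder : ∀ G₁ ∈ hull F, ∀ G₂ ∈ P1 S,
    |riskmetric h G₁ - riskmetric h G₂| ≤ L * wasserstein G₁ G₂ ^ q
  /-- Mixture Hölder continuity with exponent `r` at the optimal mixture. -/
  mixture_holder : ∀ G ∈ hull F,
    riskmetric h (mixture α F) - riskmetric h G ≤ L * wasserstein (mixture α F) G ^ r
  ratio_le : mixRatio F ≤ W

/-! ### Discretization and gaps -/

/-- The discretized simplex: each coordinate is the midpoint `ε (n + 1/2)` of an interval of
length `ε`, except that the last coordinate, which is still at least `ε / 2`, takes up the deficit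
or excess when `1/ε - K/2` is not an integer. -/
def grid (K : ℕ) (ε : ℝ) : Set (Fin K → ℝ) :=
  {a | a ∈ stdSimplex ℝ (Fin K) ∧
    (∀ i : Fin K, (i : ℕ) + 1 < K → ∃ n : ℕ, a i = ε * (n + 1 / 2)) ∧
    ∀ i : Fin K, (i : ℕ) + 1 = K → ε / 2 ≤ a i}

/-- The minimum sub-optimality gap `Δ_min(ε)`, the least value of `V(a⋆) - V(a)` over grid points
`a ≠ a⋆`, where `a⋆` is a maximizer on the grid. It is `0` if the maximizer is not unique. -/
def minGap {K : ℕ} (h : ℝ → ℝ) (F : Fin K → Measure ℝ) (ε : ℝ) : ℝ :=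
  sInf {d | ∃ b ∈ argmaxOn (grid K ε) (mixValue h F), ∃ a ∈ grid K ε, a ≠ b ∧
    d = mixValue h F b - mixValue h F a}

/-- `β` exists: `log Δ_min(ε) / log ε → β` as `ε → 0` from the right. -/
def HasGapExponent {K : ℕ} (h : ℝ → ℝ) (F : Fin K → Measure ℝ) (β : ℝ) : Prop :=
  (∀ᶠ ε in 𝓝[>] (0 : ℝ), 0 < minGap h F ε) ∧
    Tendsto (fun ε => Real.log (minGap h F ε) / Real.log ε) (𝓝[>] 0) (𝓝 β)

/-- The set `𝒬` of sample sizes at which the confidence radius resolves the gap. -/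
def resolving {K : ℕ} (h : ℝ → ℝ) (F : Fin K → Measure ℝ) (q L ρ ε : ℝ) : Set ℕ :=
  {s | (√(2 * Real.exp 1 * Real.log s) + 32) / √(ρ / 4 * s * ε) ≤
    1 / 16 * (minGap h F ε / (2 * K * L)) ^ (1 / q)}

/-- `T > max {e^K, T(ε)}` with `T(ε) = (2/ε)(T₀(ε) - 1)`, where `T₀(ε)` is the least `t ≥ 1` such
that all `s ≥ t` are in `𝒬`. If there is no such `t` then `T(ε) = ∞` and the condition fails. -/
def LongHorizon {K : ℕ} (h : ℝ → ℝ) (F : Fin K → Measure ℝ) (q L ρ ε : ℝ) (T : ℕ) : Prop :=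
  ∃ T₀ : ℕ, IsLeast {t : ℕ | 1 ≤ t ∧ ∀ s, t ≤ s → s ∈ resolving h F q L ρ ε} T₀ ∧
    max (Real.exp K) (2 / ε * ((T₀ : ℝ) - 1)) < T

/-! ### Bandit runs -/

section Run

variable {K : ℕ} {X : Type*}

/-- The rewards: `Y i n` is the reward of the `(n+1)`-st pull of arm `i`; all of them are
independent, and those of arm `i` have law `F i`. -/
structure IsRewardTable [MeasurableSpace X] (P : Measure X) (F : Fin K → Measure ℝ)
    (Y : Fin K → ℕ → X → ℝ) : Prop where
  measurable : ∀ i n, Measurable (Y i n)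
  law : ∀ i n, P.map (Y i n) = F i
  indep : iIndepFun (fun p : Fin K × ℕ => Y p.1 p.2) P

/-- `τ_t(i)`: how often arm `i` is pulled in the first `t` rounds; `A s` is the arm of
round `s + 1`. -/
def pulls (A : ℕ → X → Fin K) (t : ℕ) (i : Fin K) (ω : X) : ℕ :=
  ((Finset.range t).filter fun s => A s ω = i).card

/-- The reward observed in round `s + 1`. -/
def observed (A : ℕ → X → Fin K) (Y : Fin K → ℕ → X → ℝ) (s : ℕ) (ω : X) : ℝ :=
  Y (A s ω) (pulls A s (A s ω) ω) ω

/-- The empirical distribution of arm `i` after `t` rounds. -/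
def empirical (A : ℕ → X → Fin K) (Y : Fin K → ℕ → X → ℝ) (t : ℕ) (i : Fin K) (ω : X) :
    Measure ℝ :=
  (pulls A t i ω : ℝ≥0∞)⁻¹ •
    ∑ s ∈ (Finset.range t).filter (fun s => A s ω = i), Measure.dirac (observed A Y s ω)

/-- The confidence radius for an arm with `n` samples and horizon `T`. -/
def radius (T n : ℕ) : ℝ := 16 * ((√(2 * Real.exp 1 * Real.log T) + 32) / √n)

/-- The distribution confidence space of arm `i` after `t` rounds. -/
def confSet (S : Set ℝ) (T : ℕ) (A : ℕ → X → Fin K) (Y : Fin K → ℕ → X → ℝ) (t : ℕ)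
    (i : Fin K) (ω : X) : Set (Measure ℝ) :=
  {η | η ∈ P1 S ∧ wasserstein (empirical A Y t i ω) η ≤ radius T (pulls A t i ω)}

/-- The index maximized by RS-UCB-M: the largest riskmetric over the confidence spaces. -/
def rsIndex (S : Set ℝ) (h : ℝ → ℝ) (T : ℕ) (A : ℕ → X → Fin K) (Y : Fin K → ℕ → X → ℝ)
    (t : ℕ) (ω : X) (a : Fin K → ℝ) : ℝ :=
  sSup {u | ∃ η : Fin K → Measure ℝ, (∀ i, η i ∈ confSet S T A Y t i ω) ∧ u = mixValue h η a}

/-- The index maximized by CE-UCB-M. -/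
def ceIndex (h : ℝ → ℝ) (q L : ℝ) (T : ℕ) (A : ℕ → X → Fin K) (Y : Fin K → ℕ → X → ℝ)
    (t : ℕ) (ω : X) (a : Fin K → ℝ) : ℝ :=
  mixValue h (fun i => empirical A Y t i ω) a +
    L * ∑ i, (a i * radius T (pulls A t i ω)) ^ q

/-- The number of initial pulls of each arm. -/
def exploreLen (ρ ε : ℝ) (T : ℕ) : ℕ := ⌈ρ * T * ε / 4⌉₊

/-- The arms `A` are selected by the UCB algorithm for mixtures with the given index, with horizon
`T`, exploration rate `ρ` and discretization level `ε`; `a t` is the mixing vector computed after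
`t` rounds. Ties are broken arbitrarily, possibly at random. -/
structure FollowsUCB [MeasurableSpace X] (P : Measure X) (ρ ε : ℝ) (T : ℕ)
    (index : ℕ → X → (Fin K → ℝ) → ℝ) (A : ℕ → X → Fin K) (a : ℕ → X → Fin K → ℝ) : Prop where
  measurable : ∀ t, Measurable (A t)
  /-- The first rounds pull each arm equally often. -/
  explore : ∀ᵐ ω ∂P, ∀ i, pulls A (K * exploreLen ρ ε T) i ω = exploreLen ρ ε T
  /-- The mixing vector maximizes the index over the grid. -/
  optimistic : ∀ᵐ ω ∂P, ∀ t, K * exploreLen ρ ε T ≤ t → t < T →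
    a t ω ∈ argmaxOn (grid K ε) (index t ω)
  /-- The previous mixing vector is kept as long as it is still a maximizer. -/
  keep : ∀ᵐ ω ∂P, ∀ t, K * exploreLen ρ ε T ≤ t → t + 1 < T →
    a t ω ∈ argmaxOn (grid K ε) (index (t + 1) ω) → a (t + 1) ω = a t ω
  /-- The most under-sampled arm is pulled. -/
  track : ∀ᵐ ω ∂P, ∀ t, K * exploreLen ρ ε T ≤ t → t < T →
    A t ω ∈ argmaxOn Set.univ fun i => (t : ℝ) * a t ω i - (pulls A t i ω : ℝ)

/-- The regret `V(α⋆, F) - 𝔼[V(τ_T / T, F)]`. -/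
def regret [MeasurableSpace X] (P : Measure X) (h : ℝ → ℝ) (F : Fin K → Measure ℝ)
    (α : Fin K → ℝ) (A : ℕ → X → Fin K) (T : ℕ) : ℝ :=
  mixValue h F α - ∫ ω, mixValue h F (fun i => (pulls A T i ω : ℝ) / T) ∂P

end Run

/-! ### Rates -/

/-- `κ = (2β/q + 2)⁻¹`. -/
def kappa (q β : ℝ) : ℝ := (2 * β / q + 2)⁻¹

/-- `c_U = max {r (1 + 2κ/q), 1 - κ}`. -/
def cU (q r β : ℝ) : ℝ := max (r * (1 + 2 * kappa q β / q)) (1 - kappa q β)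

/-- The order `(K^{2/q} log T / T)^κ` of the discretization level. -/
def levelOrder (q β : ℝ) (K T : ℕ) : ℝ :=
  ((K : ℝ) ^ (2 / q) * (Real.log T / T)) ^ kappa q β

end MixtureBandit

end

/-! The regret bound reduces to one event of probability at least `1 - K / T ^ 2`, on which every
arm's empirical distribution with at most `T` samples lies within its confidence radius.

Concentration: the Wasserstein distance from a sample of size `n` to its law is `1/n`-Lipschitz in
the `ℓ¹` norm of the sample. Symmetrization in one coordinate and induction on the coordinates bound
its exponential moment (`lintegral_exp_sub_integral_le_of_lipschitz_pi`). Its mean is at most `4 /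
√n`, because `E|F̂(x) - F(x)| ≤ √(F(x) (1 - F(x)) / n)` has a Gaussian tail in `x`. Markov's
inequality gives failure probability `T⁻³` for each arm and sample size, and a union bound
concludes.

Commitment: on this event both indices lie between `V(a)` and `V(a) + 2 L ∑ (a i R i) ^ q`. The
horizon condition says that already after the exploration phase this excess is below the minimum
gap, so the index maximizer is the best grid point in every later round
(`eq_of_mem_argmaxOn_of_optimistic`). From then on the target is constant, and pulling the most
under-sampled arm brings `τ_T / T` within `2 K / T` of it in `ℓ¹` (`pulls_le_of_track`).

The regret is therefore at most a discretization term `L (4 W K ε) ^ r`, a tracking term `L (2 W K /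
T) ^ q` and a failure term `B K / T ^ 2`. For `ε` of the prescribed order the first one has the
claimed rate. Since `K ≤ log T` and `r κ ≤ q / 2`, the other two are dominated by it up to constants
(`rate_le`).

Feasibility: when the gap is at least `c₀ ε ^ β`, every sample size `s ≥ T ε / 2` resolves it as
soon as a constant times `K ^ (2/q) log T / T` is at most `ε ^ (1/κ)`. This is exactly a lower bound
on `ε` of the order of the level. -/

namespace MixtureBandit

/-! ### Distribution functions and the Wasserstein distance -/

/-- The Heaviside step at `y`, which is the distribution function of the point mass at `y`. -/
noncomputable def step (y x : ℝ) : ℝ := (Set.Ici y).indicator (fun _ => (1 : ℝ)) x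

lemma step_of_le {y x : ℝ} (h : y ≤ x) : step y x = 1 := by
  simp [step, h]

lemma step_of_lt {y x : ℝ} (h : x < y) : step y x = 0 := by
  simp [step, h]

lemma measurable_step_uncurry : Measurable fun p : ℝ × ℝ => step p.1 p.2 := by
  have h : (fun p : ℝ × ℝ => step p.1 p.2) =
      {p : ℝ × ℝ | p.1 ≤ p.2}.indicator (fun _ => (1 : ℝ)) := by
    ext p
    simp [step, Set.indicator_apply]
  rw [h]
  exact measurable_const.indicator (measurableSet_le measurable_fst measurable_snd)

lemma lintegral_enorm_step_sub (a b : ℝ) :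
    ∫⁻ x, ‖step a x - step b x‖ₑ = ENNReal.ofReal |a - b| := by
  wlog hab : a ≤ b generalizing a b
  · rw [abs_sub_comm, ← this b a (le_of_not_ge hab)]
    refine lintegral_congr fun x => ?_
    rw [← enorm_neg, neg_sub]
  have h : (fun x => ‖step a x - step b x‖ₑ) = (Set.Ico a b).indicator (fun _ => (1 : ℝ≥0∞)) := by
    ext x
    by_cases h1 : a ≤ x
    · by_cases h2 : b ≤ x
      · simp [step_of_le h1, step_of_le h2, h2]
      · rw [not_le] at h2
        simp [step_of_le h1, step_of_lt h2, h1, h2]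
    · rw [not_le] at h1
      simp [step_of_lt h1, step_of_lt (h1.trans_le hab), h1]
  rw [h, lintegral_indicator_const measurableSet_Ico, one_mul, Real.volume_Ico, abs_sub_comm,
    abs_of_nonneg (sub_nonneg.2 hab)]

lemma distFun_dirac (y x : ℝ) : distFun (Measure.dirac y) x = step y x := by
  by_cases h : y ≤ x
  · simp [distFun, measureReal_def, h, step_of_le h]
  · simp [distFun, measureReal_def, h, step_of_lt (not_le.1 h)]

lemma distFun_nonneg (μ : Measure ℝ) (x : ℝ) : 0 ≤ distFun μ x := measureReal_nonneg

lemma distFun_le_one (μ : Measure ℝ) [IsProbabilityMeasure μ] (x : ℝ) : distFun μ x ≤ 1 :=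
  measureReal_le_one

lemma distFun_mono (μ : Measure ℝ) [IsFiniteMeasure μ] : Monotone (distFun μ) :=
  fun _ _ h => measureReal_mono (Set.Iic_subset_Iic.2 h)

lemma measurable_distFun (μ : Measure ℝ) [IsFiniteMeasure μ] : Measurable (distFun μ) :=
  (distFun_mono μ).measurable

lemma distFun_eq_integral (μ : Measure ℝ) [IsFiniteMeasure μ] (x : ℝ) :
    distFun μ x = ∫ y, step y x ∂μ := by
  have h : (fun y => step y x) = (Set.Iic x).indicator (fun _ => (1 : ℝ)) := by
    ext y
    simp [step, Set.indicator_apply]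
  rw [h, integral_indicator measurableSet_Iic]
  simp [distFun]

lemma integrable_step (μ : Measure ℝ) [IsFiniteMeasure μ] (x : ℝ) :
    Integrable (fun y => step y x) μ := by
  refine Integrable.of_bound (C := 1)
    (measurable_step_uncurry.comp (measurable_id.prodMk measurable_const)).aestronglyMeasurable
    (Eventually.of_forall fun y => ?_)
  by_cases h : y ≤ x
  · simp [step_of_le h]
  · simp [step_of_lt (not_le.1 h)]

lemma dirac_mem_P1 {S : Set ℝ} (hS : MeasurableSet S) {y : ℝ} (hy : y ∈ S) :
    Measure.dirac y ∈ P1 S := by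
  refine ⟨inferInstance, by simp [Measure.dirac_apply' _ hS.compl, hy], ?_⟩
  exact integrable_dirac (by simp)

/-- By Tonelli, the area between the distribution function and the step at `0` is at most `∫ |y|
∂μ`. Integrability of differences follows, so that `wasserstein`, a Bochner integral, does not take
the default value `0` on measures in `P1`. -/
lemma integrable_distFun_sub_step {S : Set ℝ} {μ : Measure ℝ} (hμ : μ ∈ P1 S) :
    Integrable fun x => distFun μ x - step 0 x := by
  have := hμ.1
  have hm : Measurable fun x => distFun μ x - step 0 x :=
    (measurable_distFun μ).sub (measurable_step_uncurry.comp (measurable_const.prodMk measurable_id))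
  refine ⟨hm.aestronglyMeasurable, ?_⟩
  calc ∫⁻ x, ‖distFun μ x - step 0 x‖ₑ
      ≤ ∫⁻ x, ∫⁻ y, ‖step y x - step 0 x‖ₑ ∂μ := by
        refine lintegral_mono fun x => ?_
        have h : distFun μ x - step 0 x = ∫ y, (step y x - step 0 x) ∂μ := by
          rw [integral_sub (integrable_step μ x) (integrable_const _), distFun_eq_integral]
          simp
        rw [h]
        exact enorm_integral_le_lintegral_enorm _
    _ = ∫⁻ y, (∫⁻ x, ‖step y x - step 0 x‖ₑ) ∂μ := by
        refine lintegral_lintegral_swap (μ := volume) (ν := μ)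
          (f := fun x y => ‖step y x - step 0 x‖ₑ) (Measurable.aemeasurable (Measurable.enorm ?_))
        exact (measurable_step_uncurry.comp (measurable_snd.prodMk measurable_fst)).sub
          (measurable_step_uncurry.comp (measurable_const.prodMk measurable_fst))
    _ = ∫⁻ y, ‖y‖ₑ ∂μ := by
        simp only [lintegral_enorm_step_sub, sub_zero]
        simp only [Real.enorm_eq_ofReal_abs]
    _ < ∞ := hμ.2.2.2

lemma integrable_distFun_sub {S S' : Set ℝ} {μ ν : Measure ℝ} (hμ : μ ∈ P1 S) (hν : ν ∈ P1 S') :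
    Integrable fun x => distFun μ x - distFun ν x := by
  have := (integrable_distFun_sub_step hμ).sub (integrable_distFun_sub_step hν)
  refine this.congr (Eventually.of_forall fun x => ?_)
  simp

lemma wasserstein_nonneg (μ ν : Measure ℝ) : 0 ≤ wasserstein μ ν :=
  integral_nonneg fun _ => abs_nonneg _

lemma wasserstein_comm (μ ν : Measure ℝ) : wasserstein μ ν = wasserstein ν μ := by
  simp only [wasserstein, abs_sub_comm]

lemma wasserstein_triangle {S₁ S₂ S₃ : Set ℝ} {μ₁ μ₂ μ₃ : Measure ℝ} (h₁ : μ₁ ∈ P1 S₁)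
    (h₂ : μ₂ ∈ P1 S₂) (h₃ : μ₃ ∈ P1 S₃) :
    wasserstein μ₁ μ₃ ≤ wasserstein μ₁ μ₂ + wasserstein μ₂ μ₃ := by
  simp only [wasserstein]
  rw [← integral_add (integrable_distFun_sub h₁ h₂).abs (integrable_distFun_sub h₂ h₃).abs]
  exact integral_mono (integrable_distFun_sub h₁ h₃).abs
    ((integrable_distFun_sub h₁ h₂).abs.add (integrable_distFun_sub h₂ h₃).abs)
    fun x => abs_sub_le _ _ _

lemma wasserstein_dirac (a b : ℝ) :
    wasserstein (Measure.dirac a) (Measure.dirac b) = |a - b| := by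
  have hi := (integrable_distFun_sub (dirac_mem_P1 MeasurableSet.univ (Set.mem_univ a))
    (dirac_mem_P1 MeasurableSet.univ (Set.mem_univ b)))
  simp only [distFun_dirac] at hi
  simp only [wasserstein, distFun_dirac]
  have := integral_norm_eq_lintegral_enorm hi.1
  simp only [Real.norm_eq_abs] at this
  rw [this, lintegral_enorm_step_sub, ENNReal.toReal_ofReal (abs_nonneg _)]

/-! ### Mixtures -/

section Mixture

variable {K : ℕ}

lemma distFun_mixture {a : Fin K → ℝ} (ha : ∀ i, 0 ≤ a i) {F : Fin K → Measure ℝ}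
    (hF : ∀ i, IsProbabilityMeasure (F i)) (x : ℝ) :
    distFun (mixture a F) x = ∑ i, a i * distFun (F i) x := by
  simp only [distFun, mixture, measureReal_def, Measure.finsetSum_apply, Measure.smul_apply,
    smul_eq_mul]
  rw [ENNReal.toReal_sum fun i _ => ENNReal.mul_ne_top ENNReal.ofReal_ne_top (measure_ne_top _ _)]
  refine Finset.sum_congr rfl fun i _ => ?_
  rw [ENNReal.toReal_mul, ENNReal.toReal_ofReal (ha i)]

lemma mixture_mem_P1 {S : Set ℝ} {a : Fin K → ℝ} (ha : a ∈ stdSimplex ℝ (Fin K))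
    {F : Fin K → Measure ℝ} (hF : ∀ i, F i ∈ P1 S) : mixture a F ∈ P1 S := by
  refine ⟨⟨?_⟩, ?_, ?_⟩
  · have : ∀ i, F i Set.univ = 1 := fun i => (hF i).1.measure_univ
    simp only [mixture, Measure.finsetSum_apply, Measure.smul_apply, smul_eq_mul, this, mul_one]
    rw [← ENNReal.ofReal_sum_of_nonneg fun i _ => ha.1 i, ha.2, ENNReal.ofReal_one]
  · simp [mixture, Measure.finsetSum_apply, (hF _).2.1]
  · exact integrable_finsetSum_measure.2 fun i _ =>
      (hF i).2.2.smul_measure ENNReal.ofReal_ne_top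

lemma wasserstein_mixture_le {S S' : Set ℝ} {a : Fin K → ℝ} (ha : a ∈ stdSimplex ℝ (Fin K))
    {F G : Fin K → Measure ℝ} (hF : ∀ i, F i ∈ P1 S) (hG : ∀ i, G i ∈ P1 S') :
    wasserstein (mixture a F) (mixture a G) ≤ ∑ i, a i * wasserstein (F i) (G i) := by
  simp only [wasserstein, ← integral_const_mul]
  rw [← integral_finsetSum _ fun i _ => (integrable_distFun_sub (hF i) (hG i)).abs.const_mul _]
  refine integral_mono
    (integrable_distFun_sub (mixture_mem_P1 ha hF) (mixture_mem_P1 ha hG)).abs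
    (integrable_finsetSum _ fun i _ => (integrable_distFun_sub (hF i) (hG i)).abs.const_mul _)
    fun x => ?_
  simp only [distFun_mixture ha.1 fun i => (hF i).1, distFun_mixture ha.1 fun i => (hG i).1]
  rw [← Finset.sum_sub_distrib]
  refine (Finset.abs_sum_le_sum_abs _ _).trans (Finset.sum_le_sum fun i _ => ?_)
  rw [← mul_sub, abs_mul, abs_of_nonneg (ha.1 i)]

/-- A crude bound on the ratios defining `mixRatio`; it shows that their supremum is a true one and
not the default value for unbounded sets. -/
lemma wasserstein_mixture_mixture_le {S : Set ℝ} {a b : Fin K → ℝ}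
    (ha : a ∈ stdSimplex ℝ (Fin K)) (hb : b ∈ stdSimplex ℝ (Fin K))
    {F : Fin K → Measure ℝ} (hF : ∀ i, F i ∈ P1 S) :
    wasserstein (mixture a F) (mixture b F) ≤
      (∑ i, wasserstein (F i) (Measure.dirac 0)) * ∑ i, |a i - b i| := by
  have h0 := dirac_mem_P1 MeasurableSet.univ (Set.mem_univ (0 : ℝ))
  have hi := fun i => (integrable_distFun_sub (hF i) h0).abs
  calc wasserstein (mixture a F) (mixture b F)
      ≤ ∑ i, |a i - b i| * wasserstein (F i) (Measure.dirac 0) := by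
        simp only [wasserstein, ← integral_const_mul]
        rw [← integral_finsetSum _ fun i _ => (hi i).const_mul _]
        refine integral_mono
          (integrable_distFun_sub (mixture_mem_P1 ha hF) (mixture_mem_P1 hb hF)).abs
          (integrable_finsetSum _ fun i _ => (hi i).const_mul _) fun x => ?_
        simp only [distFun_mixture ha.1 fun i => (hF i).1, distFun_mixture hb.1 fun i => (hF i).1]
        -- The coefficients `a i - b i` sum to zero, so a common distribution function can be
        -- subtracted; centring at the point mass at `0` makes each term integrable.
        have : ∑ i, a i * distFun (F i) x - ∑ i, b i * distFun (F i) x =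
            ∑ i, (a i - b i) * (distFun (F i) x - distFun (Measure.dirac 0) x) := by
          simp only [sub_mul, mul_sub, Finset.sum_sub_distrib, ← Finset.sum_mul, ha.2, hb.2]
          ring
        rw [this]
        refine (Finset.abs_sum_le_sum_abs _ _).trans (Finset.sum_le_sum fun i _ => ?_)
        rw [abs_mul]
    _ ≤ ∑ i, |a i - b i| * ∑ j, wasserstein (F j) (Measure.dirac 0) := by
        refine Finset.sum_le_sum fun i _ => mul_le_mul_of_nonneg_left ?_ (abs_nonneg _)
        exact Finset.single_le_sum (f := fun j => wasserstein (F j) (Measure.dirac 0))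
          (fun j _ => wasserstein_nonneg _ _) (Finset.mem_univ i)
    _ = _ := by rw [← Finset.sum_mul, mul_comm]

lemma wasserstein_mixture_mixture_le_mixRatio {S : Set ℝ} {a b : Fin K → ℝ}
    (ha : a ∈ stdSimplex ℝ (Fin K)) (hb : b ∈ stdSimplex ℝ (Fin K))
    {F : Fin K → Measure ℝ} (hF : ∀ i, F i ∈ P1 S) :
    wasserstein (mixture a F) (mixture b F) ≤ mixRatio F * ∑ i, |a i - b i| := by
  have hpos : ∀ {a b : Fin K → ℝ}, a ≠ b → 0 < ∑ i, |a i - b i| := by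
    intro a b hab
    obtain ⟨i, hi⟩ := Function.ne_iff.1 hab
    exact Finset.sum_pos' (fun i _ => abs_nonneg _)
      ⟨i, Finset.mem_univ i, abs_pos.2 (sub_ne_zero.2 hi)⟩
  by_cases hab : a = b
  · subst hab
    simp [wasserstein]
  · rw [← div_le_iff₀ (hpos hab)]
    refine le_csSup ⟨∑ i, wasserstein (F i) (Measure.dirac 0), ?_⟩ ⟨a, ha, b, hb, hab, rfl⟩
    rintro w ⟨a, ha, b, hb, hab, rfl⟩
    rw [div_le_iff₀ (hpos hab)]
    exact wasserstein_mixture_mixture_le ha hb hF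

end Mixture

/-- The distribution function vanishes on the negative half-line, so the first integral is zero and
the second has a nonnegative integrand. This bounds the loss on the bad event by `B`. -/
lemma riskmetric_nonneg {S : Set ℝ} (hS : S ⊆ Set.Ici 0) {h : ℝ → ℝ}
    (hh : ∀ u ∈ Set.Icc (0 : ℝ) 1, 0 ≤ h u) {μ : Measure ℝ} (hμ : μ ∈ P1 S) :
    0 ≤ riskmetric h μ := by
  have := hμ.1
  have h0 : ∀ x ∈ Set.Iio (0 : ℝ), h (1 - distFun μ x) - h 1 = 0 := by
    intro x hx
    have : distFun μ x = 0 := by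
      rw [distFun, measureReal_def, measure_mono_null _ hμ.2.1, ENNReal.toReal_zero]
      exact fun y hy hyS => absurd (Set.mem_Ici.1 (hS hyS))
        (not_le.2 (lt_of_le_of_lt (Set.mem_Iic.1 hy) hx))
    simp [this]
  rw [riskmetric, setIntegral_congr_fun measurableSet_Iio h0]
  simp only [integral_zero, zero_add]
  refine integral_nonneg fun x => hh _ ⟨?_, ?_⟩
  · linarith [distFun_le_one μ x]
  · linarith [distFun_nonneg μ x]

/-! ### Concentration of Lipschitz functions of sub-Gaussian samples -/

lemma exp_add_exp_neg_le {u v : ℝ} (h : |u| ≤ |v|) :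
    Real.exp u + Real.exp (-u) ≤ Real.exp v + Real.exp (-v) := by
  have := Real.cosh_le_cosh.2 h
  rw [Real.cosh_eq, Real.cosh_eq] at this
  linarith

lemma lintegral_exp_mul_sub_le {μ : Measure ℝ} {m : ℝ}
    (hμ : HasSubgaussianMGF (fun x => x - m) 1 μ) (c : ℝ) :
    ∫⁻ x, ENNReal.ofReal (Real.exp (c * (x - m))) ∂μ ≤ ENNReal.ofReal (Real.exp (c ^ 2 / 2)) := by
  rw [← ofReal_integral_eq_lintegral_ofReal (hμ.integrable_exp_mul c)
    (Eventually.of_forall fun _ => (Real.exp_pos _).le)]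
  refine ENNReal.ofReal_le_ofReal ((hμ.mgf_le c).trans (le_of_eq ?_))
  simp

lemma lintegral_lintegral_exp_mul_sub_le {μ : Measure ℝ} {m : ℝ}
    (hμ : HasSubgaussianMGF (fun x => x - m) 1 μ) (c : ℝ) :
    ∫⁻ x, ∫⁻ y, ENNReal.ofReal (Real.exp (c * (x - y))) ∂μ ∂μ ≤
      ENNReal.ofReal (Real.exp (c ^ 2)) := by
  have h : ∀ x y : ℝ, ENNReal.ofReal (Real.exp (c * (x - y))) =
      ENNReal.ofReal (Real.exp (c * (x - m))) * ENNReal.ofReal (Real.exp (-c * (y - m))) := by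
    intro x y
    rw [← ENNReal.ofReal_mul (Real.exp_pos _).le, ← Real.exp_add]
    ring_nf
  rw [lintegral_congr fun x => lintegral_congr fun y => h x y]
  have h2 : ∀ x, ∫⁻ y, ENNReal.ofReal (Real.exp (c * (x - m))) *
      ENNReal.ofReal (Real.exp (-c * (y - m))) ∂μ = ENNReal.ofReal (Real.exp (c * (x - m))) *
      ∫⁻ y, ENNReal.ofReal (Real.exp (-c * (y - m))) ∂μ := fun x =>
    lintegral_const_mul _ (by fun_prop)
  rw [lintegral_congr h2, lintegral_mul_const _ (by fun_prop)]
  refine (mul_le_mul' (lintegral_exp_mul_sub_le hμ c) (lintegral_exp_mul_sub_le hμ (-c))).trans ?_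
  rw [← ENNReal.ofReal_mul (Real.exp_pos _).le, ← Real.exp_add]
  exact ENNReal.ofReal_le_ofReal (Real.exp_le_exp.2 (by nlinarith))

lemma integrable_id_of_subGaussian {μ : Measure ℝ} [IsProbabilityMeasure μ] {m : ℝ}
    (hμ : HasSubgaussianMGF (fun x => x - m) 1 μ) : Integrable (fun x : ℝ => x) μ := by
  have h := hμ.integrable.add (integrable_const m)
  refine h.congr (Eventually.of_forall fun x => ?_)
  simp

lemma lipschitzWith_of_abs_sub_le_sum {n : ℕ} {c : ℝ} (hc : 0 ≤ c) {f : (Fin n → ℝ) → ℝ}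
    (hf : ∀ x y, |f x - f y| ≤ c * ∑ i, |x i - y i|) :
    LipschitzWith (Real.toNNReal (c * n)) f := by
  refine LipschitzWith.of_dist_le_mul fun x y => ?_
  rw [Real.coe_toNNReal _ (by positivity), Real.dist_eq, mul_assoc]
  refine (hf x y).trans (mul_le_mul_of_nonneg_left ?_ hc)
  calc ∑ i, |x i - y i| ≤ ∑ _i : Fin n, dist x y :=
        Finset.sum_le_sum fun i _ => dist_le_pi_dist x y i
    _ = n * dist x y := by simp

lemma integrable_of_abs_sub_le_sum {n : ℕ} {c : ℝ} (hc : 0 ≤ c) {f : (Fin n → ℝ) → ℝ}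
    (hf : ∀ x y, |f x - f y| ≤ c * ∑ i, |x i - y i|) {μ : Measure ℝ} [IsProbabilityMeasure μ]
    (hμ : Integrable (fun x : ℝ => x) μ) : Integrable f (Measure.pi fun _ => μ) := by
  have h : Integrable (fun x : Fin n → ℝ => |f 0| + c * ∑ i, |x i|) (Measure.pi fun _ => μ) := by
    refine (integrable_const _).add (Integrable.const_mul ?_ c)
    exact integrable_finsetSum _ fun i _ =>
      integrable_comp_eval (μ := fun _ : Fin n => μ) (f := fun x : ℝ => |x|) hμ.abs
  refine h.mono' (lipschitzWith_of_abs_sub_le_sum hc hf).continuous.aestronglyMeasurable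
    (Eventually.of_forall fun x => ?_)
  have := hf x 0
  simp only [Pi.zero_apply, sub_zero] at this
  rw [Real.norm_eq_abs]
  have h2 := abs_sub_abs_le_abs_sub (f x) (f 0)
  linarith

/-- Symmetrization: by Jensen the mean may be replaced by an independent copy inside the
exponential. Averaging over the exchange of the two copies turns `exp` into `cosh`, which is
monotone in the absolute value, so `g x - g y` can be replaced by `c * (x - y)`, whose exponential
moment factors into two sub-Gaussian ones. -/
lemma lintegral_exp_sub_integral_le_of_lipschitz {μ : Measure ℝ} [IsProbabilityMeasure μ] {m : ℝ}
    (hμ : HasSubgaussianMGF (fun x => x - m) 1 μ) {c : ℝ} (hc : 0 ≤ c) {g : ℝ → ℝ}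
    (hg : ∀ x y, |g x - g y| ≤ c * |x - y|) :
    ∫⁻ x, ENNReal.ofReal (Real.exp (g x - ∫ y, g y ∂μ)) ∂μ ≤ ENNReal.ofReal (Real.exp (c ^ 2)) := by
  have hid := integrable_id_of_subGaussian hμ
  have hcont : Continuous g := by
    refine (LipschitzWith.of_dist_le_mul (K := Real.toNNReal c) fun x y => ?_).continuous
    rw [Real.coe_toNNReal _ hc]
    exact hg x y
  have hgi : Integrable g μ := by
    refine ((integrable_const |g 0|).add (hid.abs.const_mul c)).mono' hcont.aestronglyMeasurable
      (Eventually.of_forall fun x => ?_)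
    have := hg x 0
    rw [sub_zero] at this
    have h2 := abs_sub_abs_le_abs_sub (g x) (g 0)
    rw [Real.norm_eq_abs]
    simp only [Pi.add_apply]
    linarith
  have hexp : ∀ t s : ℝ, Integrable (fun y => Real.exp (t * (s - y))) μ := by
    intro t s
    refine ((hμ.integrable_exp_mul (-t)).const_mul (Real.exp (t * (s - m)))).congr
      (Eventually.of_forall fun y => ?_)
    simp only [← Real.exp_add]
    ring_nf
  have hbound : ∀ x y, Real.exp (g x - g y) + Real.exp (g y - g x) ≤
      Real.exp (c * (x - y)) + Real.exp (c * (y - x)) := by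
    intro x y
    have := exp_add_exp_neg_le (u := g x - g y) (v := c * (x - y))
      (by rw [abs_mul, abs_of_nonneg hc]; exact hg x y)
    rw [neg_sub, ← mul_neg, neg_sub] at this
    exact this
  have hmeas : Measurable fun p : ℝ × ℝ => ENNReal.ofReal (Real.exp (g p.1 - g p.2)) := by
    have := hcont.measurable
    fun_prop
  have hjensen : ∀ x, ENNReal.ofReal (Real.exp (g x - ∫ y, g y ∂μ)) ≤
      ∫⁻ y, ENNReal.ofReal (Real.exp (g x - g y)) ∂μ := by
    intro x
    have hi : Integrable (fun y => Real.exp (g x - g y)) μ := by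
      refine ((hexp c x).add (hexp (-c) x)).mono' (by fun_prop) (Eventually.of_forall fun y => ?_)
      rw [Real.norm_eq_abs, abs_of_pos (Real.exp_pos _)]
      have h1 := hbound x y
      have h2 := Real.exp_pos (g y - g x)
      have h3 : -c * (x - y) = c * (y - x) := by ring
      simp only [Pi.add_apply, h3]
      linarith
    rw [← ofReal_integral_eq_lintegral_ofReal hi
      (Eventually.of_forall fun _ => (Real.exp_pos _).le)]
    refine ENNReal.ofReal_le_ofReal ?_
    have := convexOn_exp.map_integral_le (μ := μ) (f := fun y => g x - g y)
      Real.continuous_exp.continuousOn isClosed_univ (Eventually.of_forall fun _ => Set.mem_univ _)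
      ((integrable_const _).sub hgi) hi
    rw [integral_sub (integrable_const _) hgi] at this
    simpa using this
  refine (lintegral_mono hjensen).trans ?_
  have hswap : ∫⁻ x, ∫⁻ y, ENNReal.ofReal (Real.exp (g x - g y)) ∂μ ∂μ =
      ∫⁻ x, ∫⁻ y, ENNReal.ofReal (Real.exp (g y - g x)) ∂μ ∂μ :=
    lintegral_lintegral_swap hmeas.aemeasurable
  have hmeas2 : Measurable fun p : ℝ × ℝ => ENNReal.ofReal (Real.exp (c * (p.1 - p.2))) := by
    fun_prop
  have hswap2 : ∫⁻ x, ∫⁻ y, ENNReal.ofReal (Real.exp (c * (x - y))) ∂μ ∂μ =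
      ∫⁻ x, ∫⁻ y, ENNReal.ofReal (Real.exp (c * (y - x))) ∂μ ∂μ :=
    lintegral_lintegral_swap hmeas2.aemeasurable
  set I := ∫⁻ x, ∫⁻ y, ENNReal.ofReal (Real.exp (g x - g y)) ∂μ ∂μ with hI
  set J := ∫⁻ x, ∫⁻ y, ENNReal.ofReal (Real.exp (c * (x - y))) ∂μ ∂μ with hJ
  have hdouble : ∀ k : ℝ × ℝ → ℝ, Measurable k →
      ∫⁻ x, ∫⁻ y, ENNReal.ofReal (Real.exp (k (x, y))) ∂μ ∂μ +
        ∫⁻ x, ∫⁻ y, ENNReal.ofReal (Real.exp (k (y, x))) ∂μ ∂μ =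
      ∫⁻ x, ∫⁻ y, ENNReal.ofReal (Real.exp (k (x, y)) + Real.exp (k (y, x))) ∂μ ∂μ := by
    intro k hk
    rw [← lintegral_add_left (Measurable.lintegral_prod_right' (f := fun p : ℝ × ℝ =>
      ENNReal.ofReal (Real.exp (k p))) (by fun_prop))]
    refine lintegral_congr fun x => ?_
    rw [← lintegral_add_left (by fun_prop)]
    refine lintegral_congr fun y => ?_
    rw [ENNReal.ofReal_add (Real.exp_pos _).le (Real.exp_pos _).le]
  -- Each integral is added to its transpose, so that the comparison of hyperbolic cosines applies
  -- pointwise.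
  have h2 : I + I ≤ J + J := by
    calc I + I = ∫⁻ x, ∫⁻ y, ENNReal.ofReal (Real.exp (g x - g y) + Real.exp (g y - g x)) ∂μ ∂μ := by
          conv_lhs => arg 2; rw [hswap]
          exact hdouble (fun p => g p.1 - g p.2) (by have := hcont.measurable; fun_prop)
      _ ≤ ∫⁻ x, ∫⁻ y, ENNReal.ofReal (Real.exp (c * (x - y)) + Real.exp (c * (y - x))) ∂μ ∂μ :=
          lintegral_mono fun x => lintegral_mono fun y => ENNReal.ofReal_le_ofReal (hbound x y)
      _ = J + J := by
          conv_rhs => arg 2; rw [hswap2]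
          exact (hdouble (fun p => c * (p.1 - p.2)) (by fun_prop)).symm
  have h3 : I ≤ J := by
    by_contra hlt
    rw [not_le] at hlt
    exact absurd h2 (not_le.2 (ENNReal.add_lt_add hlt hlt))
  exact h3.trans (lintegral_lintegral_exp_mul_sub_le hμ c)

/-- Tensorization: with the first coordinate fixed, the induction hypothesis controls the
fluctuation around the partial mean `g`. Since the Lipschitz condition is in `ℓ¹`, `g` keeps the
constant `c`, and the one-dimensional bound contributes one more factor `exp (c ^ 2)`. -/
lemma lintegral_exp_sub_integral_le_of_lipschitz_pi {μ : Measure ℝ} [IsProbabilityMeasure μ]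
    {m : ℝ} (hμ : HasSubgaussianMGF (fun x => x - m) 1 μ) {c : ℝ} (hc : 0 ≤ c) (n : ℕ)
    {f : (Fin n → ℝ) → ℝ} (hf : ∀ x y, |f x - f y| ≤ c * ∑ i, |x i - y i|) :
    ∫⁻ x, ENNReal.ofReal (Real.exp (f x - ∫ y, f y ∂(Measure.pi fun _ => μ)))
      ∂(Measure.pi fun _ => μ) ≤ ENNReal.ofReal (Real.exp (n * c ^ 2)) := by
  have hid := integrable_id_of_subGaussian hμ
  induction n with
  | zero =>
    have h : ∀ x, f x = f 0 := fun x => congrArg f (Subsingleton.elim _ _)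
    simp [h]
  | succ n ih =>
    have hfi := integrable_of_abs_sub_le_sum hc hf hid
    have hmp := (measurePreserving_piFinSuccAbove (fun _ : Fin (n + 1) => μ) 0).symm
    set e := (MeasurableEquiv.piFinSuccAbove (fun _ : Fin (n + 1) => ℝ) 0).symm with he
    set ν : Measure (Fin n → ℝ) := Measure.pi fun _ => μ with hν
    have he0 : ∀ (x : ℝ) (z : Fin n → ℝ), e (x, z) 0 = x := fun x z => rfl
    have hes : ∀ (x : ℝ) (z : Fin n → ℝ) (i : Fin n), e (x, z) i.succ = z i := fun x z i => rfl
    have hlip : ∀ x z x' z', |f (e (x, z)) - f (e (x', z'))| ≤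
        c * (|x - x'| + ∑ i, |z i - z' i|) := by
      intro x z x' z'
      refine (hf _ _).trans (le_of_eq ?_)
      rw [Fin.sum_univ_succ]
      simp only [he0, hes]
    have hlz : ∀ x z z', |f (e (x, z)) - f (e (x, z'))| ≤ c * ∑ i, |z i - z' i| := by
      intro x z z'
      simpa using hlip x z x z'
    have hzi : ∀ x, Integrable (fun z => f (e (x, z))) ν := fun x =>
      integrable_of_abs_sub_le_sum hc (hlz x) hid
    set g : ℝ → ℝ := fun x => ∫ z, f (e (x, z)) ∂ν with hg
    have hgl : ∀ x y, |g x - g y| ≤ c * |x - y| := by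
      intro x y
      rw [hg]
      simp only
      rw [← integral_sub (hzi x) (hzi y)]
      refine (abs_integral_le_integral_abs).trans ?_
      calc ∫ z, |f (e (x, z)) - f (e (y, z))| ∂ν ≤ ∫ _z, c * |x - y| ∂ν := by
            refine integral_mono ((hzi x).sub (hzi y)).abs (integrable_const _) fun z => ?_
            simpa using hlip x z y z
        _ = c * |x - y| := by simp
    have hcomp : Integrable (fun p => f (e p)) (μ.prod ν) := hmp.integrable_comp_of_integrable hfi
    have hint : ∫ y, f y ∂(Measure.pi fun _ => μ) = ∫ x, g x ∂μ := by
      rw [← hmp.integral_comp e.measurableEmbedding f, integral_prod _ hcomp]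
    have hfm : Measurable f := (lipschitzWith_of_abs_sub_le_sum hc hf).continuous.measurable
    rw [hint, ← hmp.lintegral_comp_emb e.measurableEmbedding,
      lintegral_prod _ (by fun_prop)]
    have hinner : ∀ x, ∫⁻ z, ENNReal.ofReal (Real.exp (f (e (x, z)) - ∫ x, g x ∂μ)) ∂ν ≤
        ENNReal.ofReal (Real.exp (n * c ^ 2)) *
          ENNReal.ofReal (Real.exp (g x - ∫ x, g x ∂μ)) := by
      intro x
      have h1 : ∀ z, ENNReal.ofReal (Real.exp (f (e (x, z)) - ∫ x, g x ∂μ)) =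
          ENNReal.ofReal (Real.exp (f (e (x, z)) - g x)) *
            ENNReal.ofReal (Real.exp (g x - ∫ x, g x ∂μ)) := by
        intro z
        rw [← ENNReal.ofReal_mul (Real.exp_pos _).le, ← Real.exp_add]
        ring_nf
      simp only [h1]
      rw [lintegral_mul_const _ (by fun_prop)]
      gcongr
      exact ih (hlz x)
    refine (lintegral_mono hinner).trans ?_
    rw [lintegral_const_mul' _ _ ENNReal.ofReal_ne_top]
    refine (mul_le_mul_right (lintegral_exp_sub_integral_le_of_lipschitz hμ hc hgl) _).trans ?_
    rw [← ENNReal.ofReal_mul (Real.exp_pos _).le, ← Real.exp_add]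
    refine ENNReal.ofReal_le_ofReal (Real.exp_le_exp.2 (le_of_eq ?_))
    push_cast
    ring

/-! ### Wasserstein concentration of empirical distributions -/

/-- The empirical distribution of a sample. -/
noncomputable def sampleDist {n : ℕ} (y : Fin n → ℝ) : Measure ℝ :=
  mixture (fun _ : Fin n => (n : ℝ)⁻¹) fun j => Measure.dirac (y j)

lemma uniform_mem_stdSimplex {n : ℕ} (hn : n ≠ 0) :
    (fun _ : Fin n => (n : ℝ)⁻¹) ∈ stdSimplex ℝ (Fin n) := by
  refine ⟨fun _ => by positivity, ?_⟩
  simp [hn]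

lemma sampleDist_mem_P1 {n : ℕ} (hn : n ≠ 0) {S : Set ℝ} (hS : MeasurableSet S) {y : Fin n → ℝ}
    (hy : ∀ j, y j ∈ S) : sampleDist y ∈ P1 S :=
  mixture_mem_P1 (uniform_mem_stdSimplex hn) fun j => dirac_mem_P1 hS (hy j)

lemma distFun_sampleDist {n : ℕ} (y : Fin n → ℝ) (x : ℝ) :
    distFun (sampleDist y) x = (n : ℝ)⁻¹ * ∑ j, step (y j) x := by
  rw [sampleDist, distFun_mixture (fun _ => by positivity) fun _ => inferInstance, Finset.mul_sum]
  simp only [distFun_dirac]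

lemma abs_wasserstein_sampleDist_sub_le {n : ℕ} (hn : n ≠ 0) {S : Set ℝ} {μ : Measure ℝ}
    (hμ : μ ∈ P1 S) (y z : Fin n → ℝ) :
    |wasserstein (sampleDist y) μ - wasserstein (sampleDist z) μ| ≤
      (n : ℝ)⁻¹ * ∑ j, |y j - z j| := by
  have hmem : ∀ y : Fin n → ℝ, sampleDist y ∈ P1 Set.univ := fun y =>
    sampleDist_mem_P1 hn MeasurableSet.univ fun _ => Set.mem_univ _
  have h : ∀ y z : Fin n → ℝ, wasserstein (sampleDist y) μ - wasserstein (sampleDist z) μ ≤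
      (n : ℝ)⁻¹ * ∑ j, |y j - z j| := by
    intro y z
    have h1 := wasserstein_triangle (hmem y) (hmem z) hμ
    have h2 := wasserstein_mixture_le (uniform_mem_stdSimplex hn)
      (fun j => dirac_mem_P1 MeasurableSet.univ (Set.mem_univ (y j)))
      (fun j => dirac_mem_P1 MeasurableSet.univ (Set.mem_univ (z j)))
    simp only [wasserstein_dirac] at h2
    rw [← Finset.mul_sum] at h2
    simp only [sampleDist] at h1 ⊢
    linarith
  rw [abs_le]
  constructor
  · have := h z y
    simp only [abs_sub_comm (z _) (y _)] at this
    linarith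
  · exact h y z

/-- One of the two factors is a tail on the far side of `x` from `m`, to which Chernoff's bound
applies; the other is at most `1`. -/
lemma distFun_mul_one_sub_le {μ : Measure ℝ} [IsProbabilityMeasure μ] {m : ℝ}
    (hμ : HasSubgaussianMGF (fun x => x - m) 1 μ) (x : ℝ) :
    distFun μ x * (1 - distFun μ x) ≤ Real.exp (-(1 / 2) * (x - m) ^ 2) := by
  have h0 := distFun_nonneg μ x
  have h1 := distFun_le_one μ x
  rcases le_total m x with hx | hx
  · have h := hμ.measure_ge_le (sub_nonneg.2 hx)
    have hc : 1 - distFun μ x ≤ μ.real {ω | x - m ≤ ω - m} := by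
      rw [distFun, ← probReal_compl_eq_one_sub measurableSet_Iic]
      refine measureReal_mono fun y hy => ?_
      simp only [Set.compl_Iic, Set.mem_Ioi] at hy
      simp only [Set.mem_ofPred_eq]
      linarith
    have he : -(x - m) ^ 2 / (2 * ((1 : NNReal) : ℝ)) = -(1 / 2) * (x - m) ^ 2 := by
      simp
      ring
    rw [he] at h
    nlinarith
  · have h := hμ.neg.measure_ge_le (sub_nonneg.2 hx)
    have hc : distFun μ x ≤ μ.real {ω | m - x ≤ (-fun x => x - m) ω} := by
      refine measureReal_mono fun y hy => ?_
      simp only [Set.mem_Iic] at hy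
      simp only [Set.mem_ofPred_eq, Pi.neg_apply]
      linarith
    have he : -(m - x) ^ 2 / (2 * ((1 : NNReal) : ℝ)) = -(1 / 2) * (x - m) ^ 2 := by
      simp
      ring
    rw [he] at h
    nlinarith

lemma sq_integral_abs_le_variance {Ω : Type*} [MeasurableSpace Ω] {P : Measure Ω}
    [IsProbabilityMeasure P] {Z : Ω → ℝ} (hZ : MemLp Z 2 P) (h0 : ∫ ω, Z ω ∂P = 0) :
    (∫ ω, |Z ω| ∂P) ^ 2 ≤ Var[Z; P] := by
  have h1 : 0 ≤ Var[|Z|; P] := variance_nonneg _ _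
  rw [variance_eq_sub hZ.abs] at h1
  rw [variance_eq_sub hZ, h0]
  simp only [Pi.pow_apply, Pi.abs_apply, sq_abs] at h1 ⊢
  linarith

lemma integral_abs_distFun_sampleDist_sub_le {n : ℕ} (hn : n ≠ 0) {μ : Measure ℝ}
    [IsProbabilityMeasure μ] {m : ℝ} (hμ : HasSubgaussianMGF (fun x => x - m) 1 μ) (x : ℝ) :
    ∫ y, |distFun (sampleDist y) x - distFun μ x| ∂(Measure.pi fun _ : Fin n => μ) ≤
      (√n)⁻¹ * Real.exp (-(1 / 4) * (x - m) ^ 2) := by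
  set Q : Measure (Fin n → ℝ) := Measure.pi fun _ => μ with hQ
  have hsm : Measurable fun y => step y x :=
    measurable_step_uncurry.comp (measurable_id.prodMk measurable_const)
  have hsb : ∀ y, ‖step y x‖ ≤ 1 := by
    intro y
    by_cases h : y ≤ x
    · simp [step_of_le h]
    · simp [step_of_lt (not_le.1 h)]
  have hmp := fun j => measurePreserving_eval (fun _ : Fin n => μ) j
  have hL : ∀ j : Fin n, MemLp (fun y : Fin n → ℝ => step (y j) x) 2 Q := fun j =>
    MemLp.of_bound (hsm.comp (measurable_pi_apply j)).aestronglyMeasurable 1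
      (Eventually.of_forall fun y => hsb _)
  have hE : ∀ j : Fin n, ∫ y, step (y j) x ∂Q = distFun μ x := by
    intro j
    rw [distFun_eq_integral, ← (hmp j).map_eq, integral_map (measurable_pi_apply j).aemeasurable
      hsm.aestronglyMeasurable]
  have hV : ∀ j : Fin n, Var[fun y : Fin n → ℝ => step (y j) x; Q] ≤
      Real.exp (-(1 / 2) * (x - m) ^ 2) := by
    intro j
    rw [variance_eq_sub (hL j), hE]
    -- The step takes only the values `0` and `1`, so its second moment is its mean and its variance
    -- is `F(x) (1 - F(x))`.
    have hsq : ((fun y : Fin n → ℝ => step (y j) x) ^ 2) = fun y => step (y j) x := by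
      ext y
      by_cases h : y j ≤ x
      · simp [step_of_le h]
      · simp [step_of_lt (not_le.1 h)]
    rw [hsq, hE]
    refine (le_of_eq ?_).trans (distFun_mul_one_sub_le hμ x)
    ring
  have hind : iIndepFun (fun (j : Fin n) (y : Fin n → ℝ) => step (y j) x) Q :=
    iIndepFun_pi (X := fun _ y => step y x) fun j => hsm.aemeasurable
  have hsum : Var[∑ j : Fin n, fun y : Fin n → ℝ => step (y j) x; Q] ≤
      n * Real.exp (-(1 / 2) * (x - m) ^ 2) := by
    rw [IndepFun.variance_sum (fun j _ => hL j) fun i _ j _ hij => hind.indepFun hij]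
    refine (Finset.sum_le_sum fun j _ => hV j).trans ?_
    simp
  set Z : (Fin n → ℝ) → ℝ := fun y => distFun (sampleDist y) x - distFun μ x with hZ
  have hZeq : Z = fun y => (n : ℝ)⁻¹ * (∑ j : Fin n, fun y : Fin n → ℝ => step (y j) x) y
      - distFun μ x := by
    ext y
    simp [hZ, distFun_sampleDist, Finset.sum_apply]
  have hLs : MemLp (∑ j : Fin n, fun y : Fin n → ℝ => step (y j) x) 2 Q :=
    memLp_finsetSum' _ fun j _ => hL j
  have hZL : MemLp Z 2 Q := by
    rw [hZeq]
    exact (hLs.const_mul _).sub (memLp_const _)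
  have hn' : (0 : ℝ) < n := by positivity
  have hZ0 : ∫ y, Z y ∂Q = 0 := by
    rw [hZeq, integral_sub ((hLs.const_mul _).integrable (by norm_num)) (integrable_const _),
      integral_const_mul]
    simp only [Finset.sum_apply]
    rw [integral_finsetSum _ fun j _ => (hL j).integrable (by norm_num)]
    simp only [hE]
    simp
    field_simp
    ring
  have hZV : Var[Z; Q] ≤ (n : ℝ)⁻¹ * Real.exp (-(1 / 2) * (x - m) ^ 2) := by
    rw [hZeq, variance_sub_const (hLs.const_mul _).aestronglyMeasurable, variance_const_mul]
    refine (mul_le_mul_of_nonneg_left hsum (by positivity)).trans (le_of_eq ?_)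
    field_simp
  refine le_of_sq_le_sq ?_ (by positivity)
  refine (sq_integral_abs_le_variance hZL hZ0).trans (hZV.trans (le_of_eq ?_))
  rw [mul_pow, inv_pow, Real.sq_sqrt hn'.le, ← Real.exp_nat_mul]
  congr 2
  push_cast
  ring

/-- Tonelli exchanges the sample with the area integral, and the pointwise bound integrates to
`√(4π) / √n`, where `4π ≤ 16`. -/
lemma integral_wasserstein_sampleDist_le {n : ℕ} (hn : n ≠ 0) {S : Set ℝ} {μ : Measure ℝ}
    (hμS : μ ∈ P1 S) {m : ℝ} (hμ : HasSubgaussianMGF (fun x => x - m) 1 μ) :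
    ∫ y, wasserstein (sampleDist y) μ ∂(Measure.pi fun _ : Fin n => μ) ≤ 4 / √n := by
  have := hμS.1
  set Q : Measure (Fin n → ℝ) := Measure.pi fun _ => μ with hQ
  have hmem : ∀ y : Fin n → ℝ, sampleDist y ∈ P1 Set.univ := fun y =>
    sampleDist_mem_P1 hn MeasurableSet.univ fun _ => Set.mem_univ _
  have hWi : Integrable (fun y : Fin n → ℝ => wasserstein (sampleDist y) μ) Q :=
    integrable_of_abs_sub_le_sum (by positivity) (abs_wasserstein_sampleDist_sub_le hn hμS)
      (integrable_id_of_subGaussian hμ)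
  have hmeas : Measurable fun p : (Fin n → ℝ) × ℝ =>
      |distFun (sampleDist p.1) p.2 - distFun μ p.2| := by
    simp only [distFun_sampleDist]
    have h1 : ∀ j : Fin n, Measurable fun p : (Fin n → ℝ) × ℝ => step (p.1 j) p.2 := fun j =>
      measurable_step_uncurry.comp (g := fun p : ℝ × ℝ => step p.1 p.2)
        (f := fun p : (Fin n → ℝ) × ℝ => (p.1 j, p.2)) (by fun_prop)
    have h2 := measurable_distFun μ
    exact (((Finset.measurable_fun_sum _ fun j _ => h1 j).const_mul _).sub
      (h2.comp measurable_snd)).abs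
  have hgauss : Integrable fun x : ℝ => (√n)⁻¹ * Real.exp (-(1 / 4) * (x - m) ^ 2) :=
    ((integrable_exp_neg_mul_sq (by norm_num : (0 : ℝ) < 1 / 4)).comp_sub_right m).const_mul _
  have hle : ENNReal.ofReal (∫ y, wasserstein (sampleDist y) μ ∂Q) ≤
      ENNReal.ofReal (∫ x : ℝ, (√n)⁻¹ * Real.exp (-(1 / 4) * (x - m) ^ 2)) := by
    rw [ofReal_integral_eq_lintegral_ofReal hWi
      (Eventually.of_forall fun _ => wasserstein_nonneg _ _)]
    calc ∫⁻ y, ENNReal.ofReal (wasserstein (sampleDist y) μ) ∂Q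
        = ∫⁻ y, (∫⁻ x, ENNReal.ofReal |distFun (sampleDist y) x - distFun μ x|) ∂Q := by
          refine lintegral_congr fun y => ?_
          rw [wasserstein, ofReal_integral_eq_lintegral_ofReal
            (integrable_distFun_sub (hmem y) hμS).abs (Eventually.of_forall fun _ => abs_nonneg _)]
      _ = ∫⁻ x, ∫⁻ y, ENNReal.ofReal |distFun (sampleDist y) x - distFun μ x| ∂Q :=
          lintegral_lintegral_swap hmeas.ennreal_ofReal.aemeasurable
      _ ≤ ∫⁻ x, ENNReal.ofReal ((√n)⁻¹ * Real.exp (-(1 / 4) * (x - m) ^ 2)) := by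
          refine lintegral_mono fun x => ?_
          have hb : ∀ ν : Measure ℝ, IsProbabilityMeasure ν →
              |distFun ν x - distFun μ x| ≤ 1 := fun ν hν => abs_le.2
            ⟨by linarith [distFun_nonneg ν x, distFun_le_one μ x],
              by linarith [distFun_nonneg μ x, distFun_le_one ν x]⟩
          have hi : Integrable (fun y : Fin n → ℝ => |distFun (sampleDist y) x - distFun μ x|) Q :=
            Integrable.of_bound (hmeas.comp
              (measurable_id.prodMk measurable_const)).aestronglyMeasurable 1
              (Eventually.of_forall fun y => by
                rw [Real.norm_eq_abs, abs_abs]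
                exact hb _ (hmem y).1)
          rw [← ofReal_integral_eq_lintegral_ofReal hi
            (Eventually.of_forall fun _ => abs_nonneg _)]
          exact ENNReal.ofReal_le_ofReal (integral_abs_distFun_sampleDist_sub_le hn hμ x)
      _ = _ := by
          rw [ofReal_integral_eq_lintegral_ofReal hgauss
            (Eventually.of_forall fun _ =>
              mul_nonneg (inv_nonneg.2 (Real.sqrt_nonneg _)) (Real.exp_pos _).le)]
  have hint : ∫ x : ℝ, (√n)⁻¹ * Real.exp (-(1 / 4) * (x - m) ^ 2) =
      (√n)⁻¹ * √(Real.pi / (1 / 4)) := by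
    rw [integral_const_mul, integral_sub_right_eq_self (fun x => Real.exp (-(1 / 4) * x ^ 2)),
      integral_gaussian]
  have hpi : √(Real.pi / (1 / 4)) ≤ 4 := by
    rw [Real.sqrt_le_left (by norm_num)]
    linarith [Real.pi_lt_four]
  rw [hint] at hle
  have h := (ENNReal.ofReal_le_ofReal_iff
    (mul_nonneg (inv_nonneg.2 (Real.sqrt_nonneg _)) (Real.sqrt_nonneg _))).1 hle
  refine h.trans ?_
  rw [div_eq_inv_mul 4]
  exact mul_le_mul_of_nonneg_left hpi (inv_nonneg.2 (Real.sqrt_nonneg _))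

lemma pi_radius_lt_wasserstein_le {n : ℕ} (hn : n ≠ 0) {S : Set ℝ} {μ : Measure ℝ}
    (hμS : μ ∈ P1 S) {m : ℝ} (hμ : HasSubgaussianMGF (fun x => x - m) 1 μ) {T : ℕ} (hT : 1 ≤ T) :
    (Measure.pi fun _ : Fin n => μ) {y | radius T n < wasserstein (sampleDist y) μ} ≤
      ENNReal.ofReal (((T : ℝ) ^ 3)⁻¹) := by
  have := hμS.1
  set Q : Measure (Fin n → ℝ) := Measure.pi fun _ => μ with hQ
  have hn' : (0 : ℝ) < √n := Real.sqrt_pos.2 (by positivity)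
  have hT' : (1 : ℝ) ≤ T := by exact_mod_cast hT
  have hlog : 0 ≤ Real.log T := Real.log_nonneg hT'
  -- The scale is chosen so that `n * (l / n) ^ 2 = log T`. Exceeding the mean by `4 log T` after
  -- scaling then has probability at most `exp (log T - 4 log T) = T⁻³`.
  set l : ℝ := √n * √(Real.log T) with hl
  have hl0 : 0 ≤ l := by positivity
  set f : (Fin n → ℝ) → ℝ := fun y => l * wasserstein (sampleDist y) μ with hf
  have hlip : ∀ y z, |f y - f z| ≤ (l * (n : ℝ)⁻¹) * ∑ j, |y j - z j| := by
    intro y z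
    rw [hf]
    simp only
    rw [← mul_sub, abs_mul, abs_of_nonneg hl0, mul_assoc l]
    exact mul_le_mul_of_nonneg_left (abs_wasserstein_sampleDist_sub_le hn hμS y z) hl0
  have hmgf := lintegral_exp_sub_integral_le_of_lipschitz_pi hμ (c := l * (n : ℝ)⁻¹)
    (by positivity) n hlip
  have hexp : (n : ℝ) * (l * (n : ℝ)⁻¹) ^ 2 = Real.log T := by
    have h1 : √n * √n = (n : ℝ) := Real.mul_self_sqrt (by positivity)
    have h2 : √(Real.log T) * √(Real.log T) = Real.log T := Real.mul_self_sqrt hlog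
    have h3 : l ^ 2 = n * Real.log T := by
      rw [hl, mul_pow, sq, sq, h1, h2]
    have : (n : ℝ) ≠ 0 := by exact_mod_cast hn
    rw [mul_pow, h3]
    field_simp
  rw [hexp] at hmgf
  have hmean : ∫ y, f y ∂Q ≤ l * (4 / √n) := by
    rw [hf, integral_const_mul]
    exact mul_le_mul_of_nonneg_left (integral_wasserstein_sampleDist_le hn hμS hμ) hl0
  have hkey : l * (4 / √n) + 4 * Real.log T ≤ l * radius T n := by
    have h2 : √(Real.log T) * √(Real.log T) = Real.log T := Real.mul_self_sqrt hlog
    have h3 : √(Real.log T) ≤ √(2 * Real.exp 1 * Real.log T) := by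
      refine Real.sqrt_le_sqrt ?_
      have := Real.add_one_le_exp (1 : ℝ)
      nlinarith
    have h4 : l * radius T n = √(Real.log T) * (16 * (√(2 * Real.exp 1 * Real.log T) + 32)) := by
      rw [hl, radius]
      field_simp
    have h5 : l * (4 / √n) = √(Real.log T) * 4 := by
      rw [hl]
      field_simp
    rw [h4, h5]
    have h6 : 0 ≤ √(Real.log T) := Real.sqrt_nonneg _
    nlinarith
  have hsub : {y | radius T n < wasserstein (sampleDist y) μ} ⊆
      {y | ENNReal.ofReal (Real.exp (4 * Real.log T)) ≤
        ENNReal.ofReal (Real.exp (f y - ∫ y, f y ∂Q))} := by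
    intro y hy
    refine ENNReal.ofReal_le_ofReal (Real.exp_le_exp.2 ?_)
    have : l * radius T n ≤ f y := mul_le_mul_of_nonneg_left (le_of_lt hy) hl0
    linarith
  have hfm : Measurable f :=
    (lipschitzWith_of_abs_sub_le_sum (by positivity) hlip).continuous.measurable
  have hmarkov := mul_meas_ge_le_lintegral₀ (μ := Q)
    (f := fun y => ENNReal.ofReal (Real.exp (f y - ∫ y, f y ∂Q))) (by fun_prop)
    (ENNReal.ofReal (Real.exp (4 * Real.log T)))
  have hfin := (mul_le_mul_right (measure_mono hsub) _).trans (hmarkov.trans hmgf)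
  rw [mul_comm, ← ENNReal.le_div_iff_mul_le (Or.inl (by simp [Real.exp_pos]))
    (Or.inl ENNReal.ofReal_ne_top), ← ENNReal.ofReal_div_of_pos (Real.exp_pos _),
    ← Real.exp_sub] at hfin
  refine hfin.trans (le_of_eq ?_)
  congr 1
  have hT0 : (0 : ℝ) < T := by linarith
  rw [show Real.log T - 4 * Real.log T = -((3 : ℕ) * Real.log T) by push_cast; ring, Real.exp_neg,
    Real.exp_nat_mul, Real.exp_log hT0]

lemma measure_radius_lt_wasserstein_le {K : ℕ} {X : Type*} [MeasurableSpace X] {P : Measure X}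
    [IsProbabilityMeasure P] {F : Fin K → Measure ℝ} {Y : Fin K → ℕ → X → ℝ}
    (hY : IsRewardTable P F Y) {S : Set ℝ} (i : Fin K) (hF : F i ∈ P1 S) {m : ℝ}
    (hsub : HasSubgaussianMGF (fun x => x - m) 1 (F i)) {n : ℕ} (hn : n ≠ 0) {T : ℕ}
    (hT : 1 ≤ T) :
    P {ω | radius T n < wasserstein (sampleDist fun j : Fin n => Y i j ω) (F i)} ≤
      ENNReal.ofReal (((T : ℝ) ^ 3)⁻¹) := by
  have hind : iIndepFun (fun j : Fin n => Y i j) P :=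
    hY.indep.precomp (g := fun j : Fin n => (i, (j : ℕ))) fun a b h => by
      simpa [Fin.ext_iff] using h
  have hmap := (iIndepFun_iff_map_fun_eq_pi_map (f := fun j : Fin n => Y i j) fun j => (hY.measurable i j).aemeasurable).1 hind
  simp only [hY.law] at hmap
  have hWm : Measurable fun y : Fin n → ℝ => wasserstein (sampleDist y) (F i) :=
    (lipschitzWith_of_abs_sub_le_sum (by positivity)
      (abs_wasserstein_sampleDist_sub_le hn hF)).continuous.measurable
  refine le_trans (le_of_eq ?_) (pi_radius_lt_wasserstein_le hn hF hsub hT)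
  rw [← hmap, Measure.map_apply (measurable_pi_lambda (fun ω (j : Fin n) => Y i j ω) fun j => hY.measurable i j)
    (measurableSet_lt measurable_const hWm)]
  rfl

/-! ### Pull counts and empirical distributions of a run -/

section Pulls

variable {K : ℕ} {X : Type*}

lemma pulls_succ (A : ℕ → X → Fin K) (t : ℕ) (i : Fin K) (ω : X) :
    pulls A (t + 1) i ω = pulls A t i ω + if A t ω = i then 1 else 0 := by
  rw [pulls, pulls, Finset.range_add_one, Finset.filter_insert]
  split_ifs with h
  · rw [Finset.card_insert_of_notMem (by simp)]
  · simp

lemma pulls_mono (A : ℕ → X → Fin K) (i : Fin K) (ω : X) : Monotone fun t => pulls A t i ω :=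
  monotone_nat_of_le_succ fun t => by rw [pulls_succ]; exact Nat.le_add_right _ _

lemma sum_pulls (A : ℕ → X → Fin K) (t : ℕ) (ω : X) : ∑ i, pulls A t i ω = t := by
  induction t with
  | zero => simp [pulls]
  | succ t ih =>
    simp only [pulls_succ, Finset.sum_add_distrib, ih]
    simp

lemma sum_pulls_cast (A : ℕ → X → Fin K) (t : ℕ) (ω : X) : ∑ i, (pulls A t i ω : ℝ) = t := by
  exact_mod_cast sum_pulls A t ω

lemma pulls_le (A : ℕ → X → Fin K) (t : ℕ) (i : Fin K) (ω : X) : pulls A t i ω ≤ t :=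
  (Finset.card_filter_le _ _).trans (by simp)

lemma measurable_pulls [MeasurableSpace X] {A : ℕ → X → Fin K} (hA : ∀ t, Measurable (A t))
    (t : ℕ) (i : Fin K) : Measurable (pulls A t i) := by
  induction t with
  | zero =>
    have : pulls A 0 i = fun _ => 0 := by
      ext ω
      simp [pulls]
    rw [this]
    exact measurable_const
  | succ t ih =>
    have : pulls A (t + 1) i = fun ω => pulls A t i ω + if A t ω = i then 1 else 0 := by
      ext ω
      exact pulls_succ A t i ω
    rw [this]
    exact ih.add (Measurable.ite (hA t (measurableSet_singleton i)) measurable_const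
      measurable_const)

/-- The samples of arm `i` are always an initial segment of its row in the reward table. The
adaptivity of the algorithm thus enters only through the sample size, and a union bound over
deterministic sizes suffices. -/
lemma sum_dirac_observed (A : ℕ → X → Fin K) (Y : Fin K → ℕ → X → ℝ) (t : ℕ) (i : Fin K) (ω : X) :
    ∑ s ∈ (Finset.range t).filter (fun s => A s ω = i), Measure.dirac (observed A Y s ω) =
      ∑ j ∈ Finset.range (pulls A t i ω), Measure.dirac (Y i j ω) := by
  induction t with
  | zero => simp [pulls]
  | succ t ih =>
    rw [pulls_succ, Finset.range_add_one, Finset.filter_insert]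
    split_ifs with h
    · rw [Finset.sum_insert (by simp), Finset.sum_range_succ, ih, add_comm, observed, h]
    · rw [ih, add_zero]

lemma empirical_eq_sampleDist (A : ℕ → X → Fin K) (Y : Fin K → ℕ → X → ℝ) (t : ℕ) (i : Fin K)
    (ω : X) (h : pulls A t i ω ≠ 0) :
    empirical A Y t i ω = sampleDist fun j : Fin (pulls A t i ω) => Y i j ω := by
  have hn : ENNReal.ofReal ((pulls A t i ω : ℝ)⁻¹) = (pulls A t i ω : ℝ≥0∞)⁻¹ := by
    rw [ENNReal.ofReal_inv_of_pos (by positivity), ENNReal.ofReal_natCast]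
  rw [empirical, sampleDist, mixture, sum_dirac_observed, hn, ← Finset.smul_sum,
    Finset.sum_range]

/-- Pulling the most under-sampled arm keeps every pull count below its target. -/
lemma pulls_le_of_track {A : ℕ → X → Fin K} {ω : X} {b : Fin K → ℝ}
    (hb : b ∈ stdSimplex ℝ (Fin K)) {t₀ T : ℕ} (ht₀ : t₀ ≤ T)
    (hinit : ∀ i, (pulls A t₀ i ω : ℝ) ≤ T * b i + 1)
    (htrack : ∀ t, t₀ ≤ t → t < T →
      A t ω ∈ argmaxOn Set.univ fun i => (t : ℝ) * b i - (pulls A t i ω : ℝ)) (i : Fin K) :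
    (pulls A T i ω : ℝ) ≤ T * b i + 1 := by
  suffices h : ∀ t, t₀ ≤ t → t ≤ T → (pulls A t i ω : ℝ) ≤ T * b i + 1 from h T ht₀ le_rfl
  intro t ht
  induction t, ht using Nat.le_induction with
  | base => exact fun _ => hinit i
  | succ t ht ih =>
    intro htT
    rw [pulls_succ]
    split_ifs with h
    · have hmax := (htrack t ht htT).2
      rw [h] at hmax
      -- The deficits sum to zero, so the largest is nonnegative: an arm is pulled only while at or
      -- below its current target, and overshoots by at most one.
      have hnn : 0 ≤ (t : ℝ) * b i - (pulls A t i ω : ℝ) := by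
        by_contra hneg
        rw [not_le] at hneg
        have hsum : ∑ j, ((t : ℝ) * b j - (pulls A t j ω : ℝ)) = 0 := by
          rw [Finset.sum_sub_distrib, ← Finset.mul_sum, hb.2, sum_pulls_cast]
          ring
        have : ∑ j, ((t : ℝ) * b j - (pulls A t j ω : ℝ)) < 0 :=
          Finset.sum_neg (fun j _ => (hmax j (Set.mem_univ j)).trans_lt hneg) ⟨i, Finset.mem_univ i⟩
        linarith
      have hle : (t : ℝ) * b i ≤ T * b i :=
        mul_le_mul_of_nonneg_right (by exact_mod_cast (Nat.le_of_succ_le htT)) (hb.1 i)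
      push_cast
      linarith
    · simpa using ih (Nat.le_of_succ_le htT)

lemma pulls_div_mem_stdSimplex (A : ℕ → X → Fin K) {T : ℕ} (hT : 0 < T) (ω : X) :
    (fun i => (pulls A T i ω : ℝ) / T) ∈ stdSimplex ℝ (Fin K) := by
  refine ⟨fun i => by positivity, ?_⟩
  have hT' : (0 : ℝ) < T := by exact_mod_cast hT
  rw [← Finset.sum_div, sum_pulls_cast, div_self hT'.ne']

lemma sum_abs_pulls_div_sub_le {A : ℕ → X → Fin K} {ω : X} {b : Fin K → ℝ}
    (hb : b ∈ stdSimplex ℝ (Fin K)) {T : ℕ} (hT : 0 < T)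
    (h : ∀ i, (pulls A T i ω : ℝ) ≤ T * b i + 1) :
    ∑ i, |b i - (pulls A T i ω : ℝ) / T| ≤ 2 * (K / T) := by
  have hT' : (0 : ℝ) < T := by exact_mod_cast hT
  -- The one-sided bound `x ≥ -1/T` gives `|x| ≤ 2/T + x`, and the differences `x` sum to zero.
  have hterm : ∀ i, |b i - (pulls A T i ω : ℝ) / T| ≤
      2 / T + (b i - (pulls A T i ω : ℝ) / T) := by
    intro i
    have h1 : (pulls A T i ω : ℝ) / T ≤ b i + 1 / T := by
      rw [div_le_iff₀ hT', add_mul, div_mul_cancel₀ _ hT'.ne']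
      linarith [h i]
    have h2 : (2 : ℝ) / T = 1 / T + 1 / T := by ring
    have h3 : 0 < (1 : ℝ) / T := by positivity
    rw [abs_le]
    constructor <;> linarith
  refine (Finset.sum_le_sum fun i _ => hterm i).trans (le_of_eq ?_)
  rw [Finset.sum_add_distrib, Finset.sum_sub_distrib, hb.2, (pulls_div_mem_stdSimplex A hT ω).2]
  simp
  ring

end Pulls

/-! ### The discretized simplex -/

section Grid

variable {K : ℕ} {ε : ℝ}

lemma half_le_of_mem_grid (hε : 0 < ε) {a : Fin K → ℝ} (ha : a ∈ grid K ε) (i : Fin K) :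
    ε / 2 ≤ a i := by
  rcases Nat.lt_or_ge ((i : ℕ) + 1) K with h | h
  · obtain ⟨n, hn⟩ := ha.2.1 i h
    rw [hn]
    have : 0 ≤ ε * n := by positivity
    linarith
  · exact ha.2.2 i (le_antisymm i.isLt h)

lemma mul_le_two_of_mem_grid (hε : 0 < ε) {a : Fin K → ℝ} (ha : a ∈ grid K ε) :
    (K : ℝ) * ε ≤ 2 := by
  have h : ∑ _i : Fin K, ε / 2 ≤ ∑ i, a i :=
    Finset.sum_le_sum fun i _ => half_le_of_mem_grid hε ha i
  rw [ha.1.2] at h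
  simp at h
  linarith

lemma lt_one_of_mem_grid (hε : 0 < ε) (hK : 2 ≤ K) {a : Fin K → ℝ} (ha : a ∈ grid K ε)
    (i : Fin K) : a i < 1 := by
  obtain ⟨j, hj⟩ : ∃ j : Fin K, j ≠ i := by
    have : Nontrivial (Fin K) := Fin.nontrivial_iff_two_le.2 hK
    exact exists_ne i
  rw [← ha.1.2]
  exact Finset.single_lt_sum hj (Finset.mem_univ i) (Finset.mem_univ j)
    (lt_of_lt_of_le (by positivity) (half_le_of_mem_grid hε ha j)) fun k _ _ => ha.1.1 k

/-- Every point of the simplex is within `4 K ε` of the discretized simplex. -/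
lemma exists_mem_grid_sum_abs_sub_le (hK : K ≠ 0) (hε : 0 < ε) (hKε : (K : ℝ) * ε ≤ 2)
    {α : Fin K → ℝ} (hα : α ∈ stdSimplex ℝ (Fin K)) :
    ∃ a ∈ grid K ε, ∑ i, |α i - a i| ≤ 4 * (K * ε) := by
  obtain ⟨k, rfl⟩ := Nat.exists_eq_succ_of_ne_zero hK
  push_cast at hKε ⊢
  -- `M` is the number of cells left once each of the `k + 1` coordinates has received its half
  -- cell. Rounding `α i * M` down in all coordinates but the last leaves at least `ε / 2` for the
  -- last.
  set M : ℝ := 1 / ε - (k + 1) / 2 with hM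
  have hεM : ε * M = 1 - (k + 1) * ε / 2 := by
    rw [hM]
    field_simp
  have hM0 : 0 ≤ M := by
    by_contra h
    have : ε * M < 0 := mul_neg_of_pos_of_neg hε (not_le.1 h)
    linarith
  set c : Fin k → ℝ := fun i => ε * (⌊α i.castSucc * M⌋₊ + 1 / 2) with hc
  have hαsum : ∑ i : Fin k, α i.castSucc + α (Fin.last k) = 1 := by
    rw [← Fin.sum_univ_castSucc]
    exact hα.2
  have hfl : ∀ i : Fin k, (⌊α i.castSucc * M⌋₊ : ℝ) ≤ α i.castSucc * M := fun i =>
    Nat.floor_le (mul_nonneg (hα.1 _) hM0)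
  have hcsum : ∑ i, c i ≤ 1 - ε / 2 := by
    calc ∑ i, c i ≤ ∑ i : Fin k, ε * (α i.castSucc * M + 1 / 2) :=
          Finset.sum_le_sum fun i _ => by
            rw [hc]
            exact mul_le_mul_of_nonneg_left (by linarith [hfl i]) hε.le
      _ = (∑ i : Fin k, α i.castSucc) * (ε * M) + k * ε / 2 := by
          simp only [mul_add, Finset.sum_add_distrib, Finset.sum_mul]
          congr 1
          · exact Finset.sum_congr rfl fun i _ => by ring
          · simp
            ring
      _ ≤ 1 * (ε * M) + k * ε / 2 := by
          gcongr
          linarith [hα.1 (Fin.last k)]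
      _ = 1 - ε / 2 := by
          rw [hεM]
          ring
  have hterm : ∀ i, |α i.castSucc - c i| ≤ 3 / 2 * ε + α i.castSucc * ((k + 1) * ε / 2) := by
    intro i
    have h1 := hfl i
    have h2 := Nat.lt_floor_add_one (α i.castSucc * M)
    have h3 : c i = ε * ⌊α i.castSucc * M⌋₊ + ε / 2 := by
      rw [hc]
      ring
    have h4 : α i.castSucc * (ε * M) = α i.castSucc - α i.castSucc * ((k + 1) * ε / 2) := by
      rw [hεM]
      ring
    have h5 : ε * ⌊α i.castSucc * M⌋₊ ≤ α i.castSucc * (ε * M) := by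
      calc ε * (⌊α i.castSucc * M⌋₊ : ℝ) ≤ ε * (α i.castSucc * M) :=
            mul_le_mul_of_nonneg_left h1 hε.le
        _ = _ := by ring
    have h6 : α i.castSucc * (ε * M) ≤ ε * ⌊α i.castSucc * M⌋₊ + ε := by
      calc α i.castSucc * (ε * M) = ε * (α i.castSucc * M) := by ring
        _ ≤ ε * (⌊α i.castSucc * M⌋₊ + 1) := mul_le_mul_of_nonneg_left h2.le hε.le
        _ = _ := by ring
    have h7 : 0 ≤ α i.castSucc * ((k + 1) * ε / 2) := mul_nonneg (hα.1 _) (by positivity)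
    rw [h3, abs_le]
    constructor <;> linarith
  have hsumabs : ∑ i, |α i.castSucc - c i| ≤ 2 * ((k + 1) * ε) := by
    refine (Finset.sum_le_sum fun i _ => hterm i).trans ?_
    rw [Finset.sum_add_distrib, ← Finset.sum_mul _ fun i => α (Fin.castSucc i)]
    simp only [Finset.sum_const, Finset.card_univ, Fintype.card_fin, nsmul_eq_mul]
    have h1 : (∑ i : Fin k, α i.castSucc) * ((k + 1) * ε / 2) ≤ 1 * ((k + 1) * ε / 2) := by
      refine mul_le_mul_of_nonneg_right ?_ (by positivity)
      linarith [hα.1 (Fin.last k)]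
    linarith
  set a : Fin (k + 1) → ℝ := Fin.snoc (α := fun _ => ℝ) c (1 - ∑ i, c i) with ha
  have ha1 : ∀ i : Fin k, a i.castSucc = c i := fun i => by simp [ha]
  have ha2 : a (Fin.last k) = 1 - ∑ i, c i := by simp [ha]
  refine ⟨a, ⟨⟨?_, ?_⟩, ?_, ?_⟩, ?_⟩
  · intro i
    refine Fin.lastCases ?_ (fun i => ?_) i
    · rw [ha2]
      linarith
    · rw [ha1, hc]
      positivity
  · rw [Fin.sum_univ_castSucc, ha2]
    simp only [ha1]
    ring
  · intro i
    refine Fin.lastCases (fun h => ?_) (fun i _ => ?_) i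
    · simp at h
    · exact ⟨_, ha1 i⟩
  · intro i
    refine Fin.lastCases (fun _ => ?_) (fun i h => ?_) i
    · rw [ha2]
      linarith
    · have := i.isLt
      simp at h
      omega
  · rw [Fin.sum_univ_castSucc, ha2]
    simp only [ha1]
    have h1 : α (Fin.last k) - (1 - ∑ i, c i) = ∑ i : Fin k, -(α i.castSucc - c i) := by
      rw [Finset.sum_neg_distrib, Finset.sum_sub_distrib]
      linarith
    -- Both vectors sum to one, so the last coordinate errs by no more than the others together;
    -- this doubles the constant `2` to `4`.
    have h2 : |α (Fin.last k) - (1 - ∑ i, c i)| ≤ ∑ i, |α i.castSucc - c i| := by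
      rw [h1]
      refine (Finset.abs_sum_le_sum_abs _ _).trans (le_of_eq ?_)
      simp only [abs_neg]
    linarith

/-- The infimum of the empty set is `0`, so a positive gap certifies that a maximizer exists. -/
lemma argmaxOn_grid_nonempty_of_minGap_pos {h : ℝ → ℝ} {F : Fin K → Measure ℝ}
    (hgap : 0 < minGap h F ε) : ∃ b, b ∈ argmaxOn (grid K ε) (mixValue h F) := by
  by_contra hne
  push Not at hne
  have : {d | ∃ b ∈ argmaxOn (grid K ε) (mixValue h F), ∃ a ∈ grid K ε, a ≠ b ∧
      d = mixValue h F b - mixValue h F a} = ∅ := by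
    ext d
    simp only [Set.mem_ofPred_eq, Set.mem_empty_iff_false, iff_false]
    rintro ⟨b, hb, -⟩
    exact hne b hb
  rw [minGap, this, Real.sInf_empty] at hgap
  exact lt_irrefl _ hgap

/-- For the same reason the grid must contain two distinct points, which a simplex with at most one
coordinate cannot provide. -/
lemma two_le_of_minGap_pos {h : ℝ → ℝ} {F : Fin K → Measure ℝ}
    (hgap : 0 < minGap h F ε) : 2 ≤ K := by
  by_contra hK
  have hsub : ∀ a ∈ grid K ε, ∀ b ∈ grid K ε, a = b := by
    intro a ha b hb
    have : Subsingleton (Fin K) := Fin.subsingleton_iff_le_one.2 (by omega)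
    ext i
    have : ∀ c ∈ grid K ε, c i = 1 := by
      intro c hc
      rw [← hc.1.2, Fintype.sum_subsingleton _ i]
    rw [this a ha, this b hb]
  have : {d | ∃ b ∈ argmaxOn (grid K ε) (mixValue h F), ∃ a ∈ grid K ε, a ≠ b ∧
      d = mixValue h F b - mixValue h F a} = ∅ := by
    ext d
    simp only [Set.mem_ofPred_eq, Set.mem_empty_iff_false, iff_false]
    rintro ⟨b, hb, a, ha, hab, -⟩
    exact hab (hsub a ha b hb.1)
  rw [minGap, this, Real.sInf_empty] at hgap
  exact lt_irrefl _ hgap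

lemma minGap_le {h : ℝ → ℝ} {F : Fin K → Measure ℝ} {a b : Fin K → ℝ}
    (hb : b ∈ argmaxOn (grid K ε) (mixValue h F)) (ha : a ∈ grid K ε) (hab : a ≠ b) :
    minGap h F ε ≤ mixValue h F b - mixValue h F a := by
  refine csInf_le ⟨0, ?_⟩ ⟨b, hb, a, ha, hab, rfl⟩
  rintro d ⟨b, hb, a, ha, -, rfl⟩
  exact sub_nonneg.2 (hb.2 a ha)

lemma minGap_nonneg (h : ℝ → ℝ) (F : Fin K → Measure ℝ) (ε : ℝ) : 0 ≤ minGap h F ε := by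
  refine Real.sInf_nonneg ?_
  rintro d ⟨b, hb, a, ha, -, rfl⟩
  exact sub_nonneg.2 (hb.2 a ha)

end Grid

/-! ### Optimism -/

lemma rpow_sum_le_sum_rpow {ι : Type*} (s : Finset ι) {x : ι → ℝ} (hx : ∀ i, 0 ≤ x i) {q : ℝ}
    (hq : 0 < q) (hq1 : q ≤ 1) : (∑ i ∈ s, x i) ^ q ≤ ∑ i ∈ s, x i ^ q := by
  classical
  induction s using Finset.induction_on with
  | empty => simp [Real.zero_rpow hq.ne']
  | insert i s hi ih =>
    rw [Finset.sum_insert hi, Finset.sum_insert hi]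
    exact (Real.rpow_add_le_add_rpow (hx i) (Finset.sum_nonneg fun j _ => hx j) hq.le hq1).trans
      (add_le_add_right ih _)

section Optimism

variable {K : ℕ} {S : Set ℝ} {F : Fin K → Measure ℝ} {h : ℝ → ℝ} {α : Fin K → ℝ}
  {q r B L W ε : ℝ}

/-- An index that overestimates the value by less than the gap is maximized at the best point. -/
lemma eq_of_mem_argmaxOn_of_optimistic (hq : 0 < q) (hL : 0 < L) (hε : 0 < ε)
    (hgap : 0 < minGap h F ε) {index : (Fin K → ℝ) → ℝ} {R : Fin K → ℝ} (hR : ∀ i, 0 < R i)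
    (hRgap : ∀ i, R i ≤ (minGap h F ε / (2 * K * L)) ^ (1 / q))
    (hlow : ∀ a ∈ grid K ε, mixValue h F a ≤ index a)
    (hup : ∀ a ∈ grid K ε, index a ≤ mixValue h F a + L * (2 * ∑ i, (a i * R i) ^ q))
    {a b : Fin K → ℝ} (ha : a ∈ argmaxOn (grid K ε) index)
    (hb : b ∈ argmaxOn (grid K ε) (mixValue h F)) : a = b := by
  by_contra hab
  have hK := two_le_of_minGap_pos hgap
  have hK0 : (0 : ℝ) < K := by
    have : 0 < K := by omega
    exact_mod_cast this
  set g : ℝ := minGap h F ε / (2 * K * L) with hg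
  have hg0 : 0 < g := by positivity
  -- Strictness comes from `a i < 1`, since another arm has weight at least `ε / 2`. It makes the
  -- total excess strictly smaller than the gap, so a suboptimal point cannot even tie.
  have hterm : ∀ i, (a i * R i) ^ q < g := by
    intro i
    have h1 : a i * R i < R i := by
      have := lt_one_of_mem_grid hε hK ha.1 i
      nlinarith [hR i]
    calc (a i * R i) ^ q < (R i) ^ q :=
          Real.rpow_lt_rpow (mul_nonneg (ha.1.1.1 i) (hR i).le) h1 hq
      _ ≤ (g ^ (1 / q)) ^ q := Real.rpow_le_rpow (hR i).le (hRgap i) hq.le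
      _ = g := by
          rw [← Real.rpow_mul hg0.le, one_div, inv_mul_cancel₀ hq.ne', Real.rpow_one]
  have hsum : ∑ i, (a i * R i) ^ q < K * g := by
    have : ∑ i, (a i * R i) ^ q < ∑ _i : Fin K, g :=
      Finset.sum_lt_sum_of_nonempty
        ⟨⟨0, by omega⟩, Finset.mem_univ _⟩ fun i _ => hterm i
    simpa using this
  have hgL : L * (2 * (K * g)) = minGap h F ε := by
    rw [hg]
    field_simp
  have h1 := minGap_le hb ha.1 hab
  have h2 := hlow b hb.1
  have h3 := ha.2 b hb.1
  have h4 := hup a ha.1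
  have h5 : L * (2 * ∑ i, (a i * R i) ^ q) < L * (2 * (K * g)) := by gcongr
  linarith

lemma IsInstance.abs_mixValue_sub_le (hI : IsInstance S F h α q r B L W) (hq : 0 < q)
    (hq1 : q ≤ 1) (hL : 0 < L) {a : Fin K → ℝ} (ha : a ∈ stdSimplex ℝ (Fin K))
    {G : Fin K → Measure ℝ} (hG : ∀ i, G i ∈ P1 S) {δ : Fin K → ℝ}
    (hδ : ∀ i, wasserstein (F i) (G i) ≤ δ i) :
    |mixValue h F a - mixValue h G a| ≤ L * ∑ i, (a i * δ i) ^ q := by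
  have hδ0 : ∀ i, 0 ≤ δ i := fun i => (wasserstein_nonneg _ _).trans (hδ i)
  refine (hI.holder _ ⟨a, ha, rfl⟩ _ (mixture_mem_P1 ha hG)).trans ?_
  refine mul_le_mul_of_nonneg_left ?_ hL.le
  have h1 : wasserstein (mixture a F) (mixture a G) ≤ ∑ i, a i * δ i :=
    (wasserstein_mixture_le ha hI.arm_mem hG).trans
      (Finset.sum_le_sum fun i _ => mul_le_mul_of_nonneg_left (hδ i) (ha.1 i))
  exact (Real.rpow_le_rpow (wasserstein_nonneg _ _) h1 hq.le).trans
    (rpow_sum_le_sum_rpow _ (fun i => mul_nonneg (ha.1 i) (hδ0 i)) hq hq1)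

variable {X : Type*} {A : ℕ → X → Fin K} {Y : Fin K → ℕ → X → ℝ} {T t : ℕ} {ω : X}

lemma radius_nonneg (T n : ℕ) : 0 ≤ radius T n := by
  unfold radius
  positivity

lemma IsInstance.rsIndex_bounds (hI : IsInstance S F h α q r B L W) (hq : 0 < q)
    (hq1 : q ≤ 1) (hL : 0 < L) {a : Fin K → ℝ} (ha : a ∈ stdSimplex ℝ (Fin K))
    (hmem : ∀ i, empirical A Y t i ω ∈ P1 S)
    (hconf : ∀ i, wasserstein (empirical A Y t i ω) (F i) ≤ radius T (pulls A t i ω)) :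
    mixValue h F a ≤ rsIndex S h T A Y t ω a ∧ rsIndex S h T A Y t ω a ≤
      mixValue h F a + L * (2 * ∑ i, (a i * radius T (pulls A t i ω)) ^ q) := by
  -- Any `η i` in the confidence set is within two radii of `F i`, and `2 ^ q ≤ 2`. The bound also
  -- makes the supremum in the index a true one.
  have hbd : ∀ u ∈ {u | ∃ η : Fin K → Measure ℝ, (∀ i, η i ∈ confSet S T A Y t i ω) ∧
      u = mixValue h η a},
      u ≤ mixValue h F a + L * (2 * ∑ i, (a i * radius T (pulls A t i ω)) ^ q) := by
    rintro u ⟨η, hη, rfl⟩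
    have h1 := hI.abs_mixValue_sub_le hq hq1 hL ha (fun i => (hη i).1)
      (δ := fun i => 2 * radius T (pulls A t i ω)) fun i => by
        have := wasserstein_triangle (hI.arm_mem i) (hmem i) (hη i).1
        have h2 := hconf i
        rw [wasserstein_comm] at h2
        linarith [(hη i).2]
    have h2 : ∑ i, (a i * (2 * radius T (pulls A t i ω))) ^ q ≤
        2 * ∑ i, (a i * radius T (pulls A t i ω)) ^ q := by
      rw [Finset.mul_sum]
      refine Finset.sum_le_sum fun i _ => ?_
      have hx : 0 ≤ a i * radius T (pulls A t i ω) := mul_nonneg (ha.1 i) (radius_nonneg _ _)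
      rw [mul_left_comm, Real.mul_rpow (by norm_num) hx]
      refine mul_le_mul_of_nonneg_right ?_ (Real.rpow_nonneg hx _)
      calc (2 : ℝ) ^ q ≤ 2 ^ (1 : ℝ) := Real.rpow_le_rpow_of_exponent_le (by norm_num) hq1
        _ = 2 := Real.rpow_one 2
    have h3 := mul_le_mul_of_nonneg_left h2 hL.le
    linarith [(abs_le.1 h1).1]
  have hF : mixValue h F a ∈ {u | ∃ η : Fin K → Measure ℝ,
      (∀ i, η i ∈ confSet S T A Y t i ω) ∧ u = mixValue h η a} :=
    ⟨F, fun i => ⟨hI.arm_mem i, hconf i⟩, rfl⟩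
  exact ⟨le_csSup ⟨_, hbd⟩ hF, csSup_le ⟨_, hF⟩ hbd⟩

lemma IsInstance.ceIndex_bounds (hI : IsInstance S F h α q r B L W) (hq : 0 < q)
    (hq1 : q ≤ 1) (hL : 0 < L) {a : Fin K → ℝ} (ha : a ∈ stdSimplex ℝ (Fin K))
    (hmem : ∀ i, empirical A Y t i ω ∈ P1 S)
    (hconf : ∀ i, wasserstein (empirical A Y t i ω) (F i) ≤ radius T (pulls A t i ω)) :
    mixValue h F a ≤ ceIndex h q L T A Y t ω a ∧ ceIndex h q L T A Y t ω a ≤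
      mixValue h F a + L * (2 * ∑ i, (a i * radius T (pulls A t i ω)) ^ q) := by
  have h1 := hI.abs_mixValue_sub_le hq hq1 hL ha hmem
    (δ := fun i => radius T (pulls A t i ω)) fun i => by
      rw [wasserstein_comm]
      exact hconf i
  have h2 := abs_le.1 h1
  unfold ceIndex
  constructor <;> linarith [h2.1, h2.2]

end Optimism

/-! ### The event on which all empirical distributions are accurate -/

section Concentrated

variable {K : ℕ} {X : Type*}

/-- All empirical distributions with up to `T` samples are within the confidence radius. -/
def concentrated (F : Fin K → Measure ℝ) (Y : Fin K → ℕ → X → ℝ) (T : ℕ) : Set X :=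
  {ω | ∀ i, ∀ n, n ≠ 0 → n ≤ T →
    wasserstein (sampleDist fun j : Fin n => Y i j ω) (F i) ≤ radius T n}

lemma measure_compl_concentrated_le [MeasurableSpace X] {P : Measure X} [IsProbabilityMeasure P]
    {F : Fin K → Measure ℝ} {Y : Fin K → ℕ → X → ℝ} (hY : IsRewardTable P F Y) {S : Set ℝ}
    (hF : ∀ i, F i ∈ P1 S)
    (hsub : ∀ i, HasSubgaussianMGF (fun x => x - ∫ y, y ∂(F i)) 1 (F i)) {T : ℕ} (hT : 1 ≤ T) :
    P (concentrated F Y T)ᶜ ≤ ENNReal.ofReal (K / (T : ℝ) ^ 2) := by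
  have hT' : (0 : ℝ) < T := by exact_mod_cast hT
  have hcover : (concentrated F Y T)ᶜ ⊆ ⋃ i ∈ (Finset.univ : Finset (Fin K)),
      ⋃ n ∈ Finset.Icc 1 T,
        {ω | radius T n < wasserstein (sampleDist fun j : Fin n => Y i j ω) (F i)} := by
    intro ω hω
    simp only [concentrated, Set.mem_compl_iff, Set.mem_ofPred_eq] at hω
    push Not at hω
    obtain ⟨i, n, hn, hnT, hlt⟩ := hω
    simp only [Set.mem_iUnion]
    exact ⟨i, Finset.mem_univ i, n, Finset.mem_Icc.2 ⟨Nat.one_le_iff_ne_zero.2 hn, hnT⟩, hlt⟩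
  calc P (concentrated F Y T)ᶜ
      ≤ ∑ i : Fin K, ∑ n ∈ Finset.Icc 1 T,
          P {ω | radius T n < wasserstein (sampleDist fun j : Fin n => Y i j ω) (F i)} :=
        (measure_mono hcover).trans ((measure_biUnion_finset_le _ _).trans
          (Finset.sum_le_sum fun i _ => measure_biUnion_finset_le _ _))
    _ ≤ ∑ _i : Fin K, ∑ _n ∈ Finset.Icc 1 T, ENNReal.ofReal (((T : ℝ) ^ 3)⁻¹) :=
        Finset.sum_le_sum fun i _ => Finset.sum_le_sum fun n hn =>
          measure_radius_lt_wasserstein_le hY i (hF i) (hsub i)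
            (Nat.one_le_iff_ne_zero.1 (Finset.mem_Icc.1 hn).1) hT
    _ = ENNReal.ofReal (K / (T : ℝ) ^ 2) := by
        simp only [Finset.sum_const, Finset.card_univ, Fintype.card_fin, Nat.card_Icc,
          Nat.add_sub_cancel, nsmul_eq_mul]
        rw [← ENNReal.ofReal_natCast, ← ENNReal.ofReal_natCast,
          ← ENNReal.ofReal_mul (by positivity), ← ENNReal.ofReal_mul (by positivity)]
        congr 1
        field_simp

lemma ae_forall_mem [MeasurableSpace X] {P : Measure X} {F : Fin K → Measure ℝ}
    {Y : Fin K → ℕ → X → ℝ} (hY : IsRewardTable P F Y) {S : Set ℝ} (hS : MeasurableSet S)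
    (hF : ∀ i, F i ∈ P1 S) : ∀ᵐ ω ∂P, ∀ i n, Y i n ω ∈ S := by
  refine ae_all_iff.2 fun i => ae_all_iff.2 fun n => ?_
  have h0 : P.map (Y i n) Sᶜ = 0 := by
    rw [hY.law]
    exact (hF i).2.1
  rw [Measure.map_apply (hY.measurable i n) hS.compl] at h0
  exact h0

end Concentrated

/-! ### Long horizons -/

section Horizon

variable {K : ℕ} {h : ℝ → ℝ} {F : Fin K → Measure ℝ} {q L ρ ε : ℝ} {T : ℕ}

lemma LongHorizon.exp_lt (hT : LongHorizon h F q L ρ ε T) : Real.exp K < T := by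
  obtain ⟨T₀, -, h⟩ := hT
  exact (le_max_left _ _).trans_lt h

/-- A zero gap would make the right side of the resolving inequality zero, while the left side is
positive. Hence a long horizon entails a unique best grid point. -/
lemma minGap_pos_of_mem_resolving (hq : 0 < q) (hρ : 0 < ρ) (hε : 0 < ε) {s : ℕ} (hs : 0 < s)
    (hres : s ∈ resolving h F q L ρ ε) : 0 < minGap h F ε := by
  refine (minGap_nonneg _ _ _).lt_of_ne fun h0 => ?_
  have hs' : (0 : ℝ) < s := by exact_mod_cast hs
  simp only [resolving, Set.mem_ofPred_eq, ← h0, zero_div] at hres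
  rw [Real.zero_rpow (by positivity), mul_zero] at hres
  have : 0 < (√(2 * Real.exp 1 * Real.log s) + 32) / √(ρ / 4 * s * ε) := by positivity
  linarith

lemma LongHorizon.minGap_pos (hT : LongHorizon h F q L ρ ε T) (hq : 0 < q) (hρ : 0 < ρ)
    (hε : 0 < ε) : 0 < minGap h F ε := by
  obtain ⟨T₀, ⟨⟨h1, h2⟩, -⟩, -⟩ := hT
  exact minGap_pos_of_mem_resolving hq hρ hε h1 (h2 T₀ le_rfl)

lemma LongHorizon.mem_resolving (hT : LongHorizon h F q L ρ ε T) (hε : 0 < ε) (hε2 : ε ≤ 2) :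
    T ∈ resolving h F q L ρ ε := by
  obtain ⟨T₀, ⟨⟨h1, h2⟩, -⟩, h3⟩ := hT
  refine h2 T ?_
  have h4 := (le_max_right _ _).trans_lt h3
  have h1' : (0 : ℝ) ≤ (T₀ : ℝ) - 1 := by
    have : (1 : ℝ) ≤ T₀ := by exact_mod_cast h1
    linarith
  -- With `2 / ε ≥ 1`, the condition `T > T(ε)` gives `T > T₀ - 1`, that is, `T ≥ T₀`.
  have h5 : 1 ≤ 2 / ε := by rwa [le_div_iff₀ hε, one_mul]
  have h6 : (T₀ : ℝ) < T + 1 := by nlinarith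
  have h7 : T₀ < T + 1 := by exact_mod_cast h6
  omega

lemma LongHorizon.radius_le (hT : LongHorizon h F q L ρ ε T) (hρ : 0 < ρ) (hε : 0 < ε)
    (hε2 : ε ≤ 2) {n : ℕ} (hn : ρ * T * ε / 4 ≤ n) :
    radius T n ≤ (minGap h F ε / (2 * K * L)) ^ (1 / q) := by
  have hT0 : (0 : ℝ) < T := (Real.exp_pos _).trans hT.exp_lt
  have h1 := hT.mem_resolving hε hε2
  simp only [resolving, Set.mem_ofPred_eq] at h1
  have h2 : √(ρ / 4 * T * ε) ≤ √n := Real.sqrt_le_sqrt (by linarith)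
  have h3 : 0 < √(ρ / 4 * T * ε) := Real.sqrt_pos.2 (by positivity)
  have h4 : (√(2 * Real.exp 1 * Real.log T) + 32) / √n ≤
      (√(2 * Real.exp 1 * Real.log T) + 32) / √(ρ / 4 * T * ε) := by gcongr
  rw [radius]
  linarith

/-- Up to rounding, exploration takes `ρ T K ε / 4 ≤ T / 2` rounds; rounding adds at most `K ≤ log T
≤ T / 2`. -/
lemma LongHorizon.exploration_le (hT : LongHorizon h F q L ρ ε T) (hρ : 0 < ρ) (hρ1 : ρ < 1)
    (hε : 0 < ε) (hKε : (K : ℝ) * ε ≤ 2) : K * exploreLen ρ ε T ≤ T := by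
  have hT0 : (0 : ℝ) < T := (Real.exp_pos _).trans hT.exp_lt
  have hlog : (K : ℝ) ≤ Real.log T := (Real.le_log_iff_exp_le hT0).2 hT.exp_lt.le
  have h1 : Real.log T ≤ T / 2 := by
    have h2 := Real.log_le_sub_one_of_pos (half_pos hT0)
    rw [Real.log_div hT0.ne' (by norm_num)] at h2
    linarith [Real.log_two_lt_d9]
  have h3 : (exploreLen ρ ε T : ℝ) < ρ * T * ε / 4 + 1 := Nat.ceil_lt_add_one (by positivity)
  have h4 : (K : ℝ) * exploreLen ρ ε T ≤ T := by
    calc (K : ℝ) * exploreLen ρ ε T ≤ K * (ρ * T * ε / 4 + 1) := by gcongr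
      _ = ρ * (T * (K * ε)) / 4 + K := by ring
      _ ≤ 1 * (T * 2) / 4 + K := by gcongr
      _ ≤ T := by linarith
  exact_mod_cast h4

end Horizon

/-! ### The regret -/

section Regret

variable {K : ℕ} {S : Set ℝ} {F : Fin K → Measure ℝ} {h : ℝ → ℝ} {α : Fin K → ℝ}
  {q r B L W ρ ε : ℝ} {X : Type*} {A : ℕ → X → Fin K} {Y : Fin K → ℕ → X → ℝ} {T : ℕ}

lemma IsInstance.ratio_nonneg (hI : IsInstance S F h α q r B L W) : 0 ≤ W := by
  refine le_trans (Real.sSup_nonneg ?_) hI.ratio_le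
  rintro w ⟨a, -, b, -, -, rfl⟩
  exact div_nonneg (wasserstein_nonneg _ _) (Finset.sum_nonneg fun i _ => abs_nonneg _)

lemma IsInstance.arms_ne_zero (hI : IsInstance S F h α q r B L W) : K ≠ 0 := by
  rintro rfl
  have := hI.optimal.1.2
  simp at this

lemma IsInstance.wasserstein_le (hI : IsInstance S F h α q r B L W) {a b : Fin K → ℝ}
    (ha : a ∈ stdSimplex ℝ (Fin K)) (hb : b ∈ stdSimplex ℝ (Fin K)) :
    wasserstein (mixture a F) (mixture b F) ≤ W * ∑ i, |a i - b i| :=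
  (wasserstein_mixture_mixture_le_mixRatio ha hb hI.arm_mem).trans
    (mul_le_mul_of_nonneg_right hI.ratio_le (Finset.sum_nonneg fun _ _ => abs_nonneg _))

/-- On the good event the algorithm commits to the best grid point and tracks it. -/
lemma IsInstance.pulls_le_of_concentrated (hI : IsInstance S F h α q r B L W) (hq : 0 < q)
    (hq1 : q ≤ 1) (hL : 0 < L) (hρ : 0 < ρ) (hρ1 : ρ < 1) (hε : 0 < ε)
    (hT : LongHorizon h F q L ρ ε T) {index : ℕ → X → (Fin K → ℝ) → ℝ}
    (hindex : index = rsIndex S h T A Y ∨ index = ceIndex h q L T A Y)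
    {a : ℕ → X → Fin K → ℝ} {ω : X} (hconc : ω ∈ concentrated F Y T) (hmem : ∀ i n, Y i n ω ∈ S)
    (hexplore : ∀ i, pulls A (K * exploreLen ρ ε T) i ω = exploreLen ρ ε T)
    (hopt : ∀ t, K * exploreLen ρ ε T ≤ t → t < T → a t ω ∈ argmaxOn (grid K ε) (index t ω))
    (htrack : ∀ t, K * exploreLen ρ ε T ≤ t → t < T →
      A t ω ∈ argmaxOn Set.univ fun i => (t : ℝ) * a t ω i - (pulls A t i ω : ℝ))
    {b : Fin K → ℝ} (hb : b ∈ argmaxOn (grid K ε) (mixValue h F)) (i : Fin K) :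
    (pulls A T i ω : ℝ) ≤ T * b i + 1 := by
  have hgap := hT.minGap_pos hq hρ hε
  have hKε := mul_le_two_of_mem_grid hε hb.1
  have hK2 : (2 : ℝ) ≤ K := by exact_mod_cast two_le_of_minGap_pos hgap
  have hε2 : ε ≤ 2 := by nlinarith
  have hT0 : (0 : ℝ) < T := (Real.exp_pos _).trans hT.exp_lt
  have hlen := hT.exploration_le hρ hρ1 hε hKε
  have hN0 : 0 < exploreLen ρ ε T := Nat.ceil_pos.2 (by positivity)
  refine pulls_le_of_track hb.1.1 hlen (fun i => ?_) (fun t ht htT => ?_) i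
  -- Exploration does not overshoot the target by more than one pull, because each coordinate of a
  -- grid point is at least `ε / 2`.
  · rw [hexplore i]
    have h1 : (exploreLen ρ ε T : ℝ) < ρ * T * ε / 4 + 1 := Nat.ceil_lt_add_one (by positivity)
    have h2 := half_le_of_mem_grid hε hb.1 i
    have h3 : ρ * T * ε / 4 ≤ T * b i := by
      calc ρ * T * ε / 4 ≤ 1 * T * ε / 4 := by gcongr
        _ ≤ T * (ε / 2) := by nlinarith [mul_pos hT0 hε]
        _ ≤ T * b i := by gcongr
    linarith
  · have hpulls : ∀ i, exploreLen ρ ε T ≤ pulls A t i ω := fun i => by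
      rw [← hexplore i]
      exact pulls_mono A i ω ht
    have hne : ∀ i, pulls A t i ω ≠ 0 := fun i => (hN0.trans_le (hpulls i)).ne'
    have hemp : ∀ i, empirical A Y t i ω ∈ P1 S := fun i => by
      rw [empirical_eq_sampleDist A Y t i ω (hne i)]
      exact sampleDist_mem_P1 (hne i) hI.measurableSet fun j => hmem i j
    have hconf : ∀ i, wasserstein (empirical A Y t i ω) (F i) ≤ radius T (pulls A t i ω) :=
      fun i => by
        rw [empirical_eq_sampleDist A Y t i ω (hne i)]
        exact hconc i _ (hne i) ((pulls_le A t i ω).trans htT.le)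
    have hRgap : ∀ i, radius T (pulls A t i ω) ≤ (minGap h F ε / (2 * K * L)) ^ (1 / q) :=
      fun i => hT.radius_le hρ hε hε2
        ((Nat.le_ceil _).trans (by exact_mod_cast hpulls i))
    have hRpos : ∀ i, 0 < radius T (pulls A t i ω) := fun i => by
      have : 0 < pulls A t i ω := Nat.pos_of_ne_zero (hne i)
      unfold radius
      positivity
    have hbounds : ∀ c ∈ grid K ε, mixValue h F c ≤ index t ω c ∧ index t ω c ≤
        mixValue h F c + L * (2 * ∑ i, (c i * radius T (pulls A t i ω)) ^ q) := by
      intro c hc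
      rcases hindex with rfl | rfl
      · exact hI.rsIndex_bounds hq hq1 hL hc.1 hemp hconf
      · exact hI.ceIndex_bounds hq hq1 hL hc.1 hemp hconf
    have heq : a t ω = b := eq_of_mem_argmaxOn_of_optimistic hq hL hε hgap hRpos hRgap
      (fun c hc => (hbounds c hc).1) (fun c hc => (hbounds c hc).2) (hopt t ht htT) hb
    rw [← heq]
    exact htrack t ht htT

/-- A grid point close to `α` costs the mixture Hölder term, the best grid point is at least as
good, and the passage from it to `p` costs the Hölder term. -/
lemma IsInstance.mixValue_sub_le (hI : IsInstance S F h α q r B L W) (hq : 0 < q) (hr : 0 < r)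
    (hL : 0 < L) (hε : 0 < ε) {b : Fin K → ℝ}
    (hb : b ∈ argmaxOn (grid K ε) (mixValue h F)) {p : Fin K → ℝ}
    (hp : p ∈ stdSimplex ℝ (Fin K)) {η : ℝ} (hbp : ∑ i, |b i - p i| ≤ η) :
    mixValue h F α - mixValue h F p ≤ L * (W * (4 * (K * ε))) ^ r + L * (W * η) ^ q := by
  have hW := hI.ratio_nonneg
  obtain ⟨a, ha, haα⟩ := exists_mem_grid_sum_abs_sub_le hI.arms_ne_zero hε
    (mul_le_two_of_mem_grid hε hb.1) hI.optimal.1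
  have h1 : mixValue h F α - mixValue h F a ≤ L * (W * (4 * (K * ε))) ^ r := by
    refine (hI.mixture_holder _ ⟨a, ha.1, rfl⟩).trans (mul_le_mul_of_nonneg_left ?_ hL.le)
    exact Real.rpow_le_rpow (wasserstein_nonneg _ _)
      ((hI.wasserstein_le hI.optimal.1 ha.1).trans (mul_le_mul_of_nonneg_left haα hW)) hr.le
  have h2 : mixValue h F b - mixValue h F p ≤ L * (W * η) ^ q := by
    refine (le_abs_self _).trans ((hI.holder _ ⟨b, hb.1.1, rfl⟩ _
      (mixture_mem_P1 hp hI.arm_mem)).trans (mul_le_mul_of_nonneg_left ?_ hL.le))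
    exact Real.rpow_le_rpow (wasserstein_nonneg _ _)
      ((hI.wasserstein_le hb.1.1 hp).trans (mul_le_mul_of_nonneg_left hbp hW)) hq.le
  linarith [hb.2 a ha]

/-- The pull counts live in a countable discrete space, where every function is measurable. -/
lemma measurable_mixValue_pulls [MeasurableSpace X] (hA : ∀ t, Measurable (A t)) :
    Measurable fun ω => mixValue h F fun i => (pulls A T i ω : ℝ) / T := by
  have h1 : Measurable fun ω i => pulls A T i ω :=
    measurable_pi_lambda _ fun i => measurable_pulls hA T i
  exact (Measurable.of_discrete
    (f := fun v : Fin K → ℕ => mixValue h F fun i => (v i : ℝ) / T)).comp h1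

lemma IsInstance.regret_le [MeasurableSpace X] {P : Measure X} [IsProbabilityMeasure P]
    (hI : IsInstance S F h α q r B L W) (hq : 0 < q) (hq1 : q ≤ 1) (hr : 0 < r) (hB : 0 < B)
    (hL : 0 < L) (hρ : 0 < ρ) (hρ1 : ρ < 1) (hε : 0 < ε) (hT : LongHorizon h F q L ρ ε T)
    {index : ℕ → X → (Fin K → ℝ) → ℝ}
    (hindex : index = rsIndex S h T A Y ∨ index = ceIndex h q L T A Y)
    {a : ℕ → X → Fin K → ℝ} (hY : IsRewardTable P F Y)
    (hrun : FollowsUCB P ρ ε T index A a) :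
    regret P h F α A T ≤
      L * (W * (4 * (K * ε))) ^ r + L * (W * (2 * (K / T))) ^ q + B * (K / (T : ℝ) ^ 2) := by
  have hW := hI.ratio_nonneg
  have hT0 : (0 : ℝ) < T := (Real.exp_pos _).trans hT.exp_lt
  have hTnat : 0 < T := by exact_mod_cast hT0
  obtain ⟨b, hb⟩ := argmaxOn_grid_nonempty_of_minGap_pos (hT.minGap_pos hq hρ hε)
  set D : ℝ := L * (W * (4 * (K * ε))) ^ r + L * (W * (2 * (K / T))) ^ q with hD
  have hD0 : 0 ≤ D := by positivity
  set V : X → ℝ := fun ω => mixValue h F fun i => (pulls A T i ω : ℝ) / T with hV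
  have hp := fun ω => pulls_div_mem_stdSimplex A hTnat ω
  have hV0 : ∀ ω, 0 ≤ V ω := fun ω =>
    riskmetric_nonneg hI.nonneg (fun u hu => (hI.distortion_mem u hu).1)
      (mixture_mem_P1 (hp ω) hI.arm_mem)
  have hVB : ∀ ω, V ω ≤ B := fun ω => hI.bounded _ ⟨_, hp ω, rfl⟩
  have hαB : mixValue h F α ≤ B := hI.bounded _ ⟨α, hI.optimal.1, rfl⟩
  have hVi : Integrable V P :=
    Integrable.of_bound (measurable_mixValue_pulls hrun.measurable).aestronglyMeasurable B
      (Eventually.of_forall fun ω => by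
        rw [Real.norm_eq_abs, abs_of_nonneg (hV0 ω)]
        exact hVB ω)
  -- A measurable hull of the bad event has the same measure and can be integrated over.
  set E : Set X := toMeasurable P (concentrated F Y T)ᶜ with hE
  have hEm : MeasurableSet E := measurableSet_toMeasurable _ _
  have hPE : P.real E ≤ K / (T : ℝ) ^ 2 := by
    rw [measureReal_def, hE, measure_toMeasurable]
    exact ENNReal.toReal_le_of_le_ofReal (by positivity)
      (measure_compl_concentrated_le hY hI.arm_mem hI.subGaussian hTnat)
  have hae : ∀ᵐ ω ∂P, mixValue h F α - D - E.indicator (fun _ => B) ω ≤ V ω := by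
    filter_upwards [ae_forall_mem hY hI.measurableSet hI.arm_mem, hrun.explore, hrun.optimistic,
      hrun.track] with ω hmem hexplore hopt htrack
    by_cases hω : ω ∈ E
    · rw [Set.indicator_of_mem hω]
      linarith [hV0 ω]
    · rw [Set.indicator_of_notMem hω]
      have hconc : ω ∈ concentrated F Y T := by
        by_contra hc
        exact hω (subset_toMeasurable _ _ hc)
      have h1 := hI.pulls_le_of_concentrated hq hq1 hL hρ hρ1 hε hT hindex hconc hmem hexplore
        hopt htrack hb
      have h2 := hI.mixValue_sub_le hq hr hL hε hb (hp ω)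
        (sum_abs_pulls_div_sub_le hb.1.1 hTnat h1)
      linarith
  have hind : Integrable (E.indicator fun _ => B) P := (integrable_const B).indicator hEm
  have hint := integral_mono_ae ((integrable_const _).sub hind) hVi hae
  simp only [Pi.sub_apply] at hint
  rw [integral_sub (integrable_const _) hind, integral_indicator_const _ hEm] at hint
  simp only [integral_const, probReal_univ, smul_eq_mul, one_mul] at hint
  have hBE : P.real E * B ≤ B * (K / (T : ℝ) ^ 2) := by
    rw [mul_comm]
    exact mul_le_mul_of_nonneg_left hPE hB.le
  rw [regret]
  linarith

end Regret

/-! ### Rates -/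

section Rates

variable {q r β : ℝ}

lemma kappa_eq (hq : 0 < q) : kappa q β = q / (2 * (β + q)) := by
  rw [kappa]
  have : 2 * β / q + 2 = 2 * (β + q) / q := by
    field_simp
  rw [this, inv_div]

lemma kappa_pos (hq : 0 < q) (hr : 0 < r) (hrβ : r ≤ β + q / 2) : 0 < kappa q β := by
  rw [kappa_eq hq]
  exact div_pos hq (by linarith)

lemma kappa_lt_one (hq : 0 < q) (hr : 0 < r) (hrβ : r ≤ β + q / 2) : kappa q β < 1 := by
  rw [kappa_eq hq, div_lt_one (by linarith)]
  linarith

/-- Equivalent to `r ≤ β + q`, a consequence of `r ≤ β + q / 2`; it makes the tracking and failure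
terms of lower order. -/
lemma mul_kappa_le (hq : 0 < q) (hr : 0 < r) (hrβ : r ≤ β + q / 2) : r * kappa q β ≤ q / 2 := by
  rw [kappa_eq hq, mul_div_assoc', div_le_iff₀ (by linarith)]
  nlinarith

lemma cU_pos (hq : 0 < q) (hr : 0 < r) (hrβ : r ≤ β + q / 2) : 0 < cU q r β :=
  lt_max_of_lt_right (sub_pos.2 (kappa_lt_one hq hr hrβ))

lemma rate_le {B L W c₂ ε : ℝ} (hq : 0 < q) (hq1 : q ≤ 1) (hr : 0 < r) (hrβ : r ≤ β + q / 2)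
    (hB : 0 < B) (hL : 0 < L) (hW : 0 ≤ W) (hc₂ : 0 < c₂) {K T : ℕ} (hK : K ≠ 0)
    (hT : Real.exp K < T) (hε : 0 < ε) (hεle : ε ≤ c₂ * levelOrder q β K T) :
    L * (W * (4 * (K * ε))) ^ r + L * (W * (2 * (K / T))) ^ q + B * (K / (T : ℝ) ^ 2) ≤
      (L * (4 * W * c₂) ^ r + L * (2 * W) ^ q + B) * (K : ℝ) ^ cU q r β *
        (Real.log T / T) ^ (r * kappa q β) := by
  have hT0 : (0 : ℝ) < T := (Real.exp_pos _).trans hT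
  have hK1 : (1 : ℝ) ≤ K := by exact_mod_cast Nat.one_le_iff_ne_zero.2 hK
  have hK0 : (0 : ℝ) < K := by linarith
  have hlogK : (K : ℝ) ≤ Real.log T := (Real.le_log_iff_exp_le hT0).2 hT.le
  have hκ := kappa_pos hq hr hrβ
  have hrκ := mul_kappa_le hq hr hrβ
  set κ := kappa q β with hκdef
  set Λ : ℝ := Real.log T / T with hΛ
  have hΛ0 : 0 < Λ := div_pos (by linarith) hT0
  have hΛ1 : Λ ≤ 1 := by
    rw [hΛ, div_le_one hT0]
    linarith [Real.log_le_sub_one_of_pos hT0]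
  have hKT : (K : ℝ) / T ≤ Λ := by
    rw [hΛ]
    gcongr
  have hKU : 1 ≤ (K : ℝ) ^ cU q r β := Real.one_le_rpow hK1 (cU_pos hq hr hrβ).le
  have hΛp : 0 < Λ ^ (r * κ) := Real.rpow_pos_of_pos hΛ0 _
  set M : ℝ := (K : ℝ) ^ cU q r β * Λ ^ (r * κ) with hM
  have hΛM : Λ ^ (r * κ) ≤ M := le_mul_of_one_le_left hΛp.le hKU
  have h1 : (W * (4 * (K * ε))) ^ r ≤ (4 * W * c₂) ^ r * M := by
    -- The discretization error scales with `K ε`; its `r`-th power produces the first branch of the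
    -- maximum in `cU`.
    have hx : K * levelOrder q β K T = (K : ℝ) ^ (1 + 2 * κ / q) * Λ ^ κ := by
      rw [levelOrder, Real.mul_rpow (by positivity) hΛ0.le, ← Real.rpow_mul hK0.le,
        Real.rpow_add hK0, Real.rpow_one, ← hκdef]
      ring_nf
    calc (W * (4 * (K * ε))) ^ r
        ≤ (W * (4 * (K * (c₂ * levelOrder q β K T)))) ^ r := by gcongr
      _ = (4 * W * c₂ * ((K : ℝ) ^ (1 + 2 * κ / q) * Λ ^ κ)) ^ r := by
          rw [← hx]
          ring_nf
      _ = (4 * W * c₂) ^ r * ((K : ℝ) ^ (r * (1 + 2 * κ / q)) * Λ ^ (r * κ)) := by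
          rw [Real.mul_rpow (x := 4 * W * c₂) (by positivity) (by positivity),
            Real.mul_rpow (x := (K : ℝ) ^ _) (by positivity) (by positivity),
            ← Real.rpow_mul hK0.le,
            ← Real.rpow_mul hΛ0.le, mul_comm r, mul_comm r]
      _ ≤ (4 * W * c₂) ^ r * M := by
          have : (K : ℝ) ^ (r * (1 + 2 * κ / q)) ≤ (K : ℝ) ^ cU q r β :=
            Real.rpow_le_rpow_of_exponent_le hK1 (le_max_left _ _)
          rw [hM]
          gcongr
  have h2 : (W * (2 * (K / T))) ^ q ≤ (2 * W) ^ q * M := by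
    calc (W * (2 * (K / T))) ^ q ≤ (W * (2 * Λ)) ^ q := by gcongr
      _ = (2 * W) ^ q * Λ ^ q := by
          rw [← Real.mul_rpow (by positivity) hΛ0.le]
          ring_nf
      _ ≤ (2 * W) ^ q * M := by
          have : Λ ^ q ≤ Λ ^ (r * κ) :=
            Real.rpow_le_rpow_of_exponent_ge hΛ0 hΛ1 (by linarith)
          gcongr
          exact this.trans hΛM
  have h3 : (K : ℝ) / (T : ℝ) ^ 2 ≤ M := by
    have hT1 : (1 : ℝ) ≤ T := (Real.one_le_exp (by positivity)).trans hT.le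
    calc (K : ℝ) / (T : ℝ) ^ 2 ≤ K / T := by
          gcongr
          nlinarith
      _ ≤ Λ ^ (1 : ℝ) := by rwa [Real.rpow_one]
      _ ≤ Λ ^ (r * κ) := Real.rpow_le_rpow_of_exponent_ge hΛ0 hΛ1 (by linarith)
      _ ≤ M := hΛM
  calc _ ≤ L * ((4 * W * c₂) ^ r * M) + L * ((2 * W) ^ q * M) + B * M := by gcongr
    _ = _ := by
      rw [hM]
      ring

/-! ### Feasibility of the discretization level -/

lemma levelOrder_pos {K T : ℕ} (hK : K ≠ 0) (hT : 2 ≤ T) : 0 < levelOrder q β K T := by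
  have hT' : (2 : ℝ) ≤ T := by exact_mod_cast hT
  have : 0 < Real.log T := Real.log_pos (by linarith)
  unfold levelOrder
  positivity

lemma tendsto_levelOrder (hκ : 0 < kappa q β) (K : ℕ) :
    Tendsto (levelOrder q β K) atTop (𝓝 0) := by
  have h1 : Tendsto (fun x : ℝ => Real.log x / x) atTop (𝓝 0) :=
    Real.isLittleO_log_id_atTop.tendsto_div_nhds_zero
  have h2 := (h1.comp tendsto_natCast_atTop_atTop).const_mul ((K : ℝ) ^ (2 / q))
  rw [mul_zero] at h2
  have h3 := h2.rpow_const (p := kappa q β) (Or.inr hκ.le)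
  rw [Real.zero_rpow hκ.ne'] at h3
  exact h3

/-- Once `log T ≥ 1`, the level is at least `T ^ (-κ)`, and `κ < 1`. -/
lemma tendsto_mul_levelOrder (hq : 0 < q) (hκ : 0 < kappa q β) (hκ1 : kappa q β < 1) {K : ℕ}
    (hK : K ≠ 0) : Tendsto (fun T : ℕ => (T : ℝ) * levelOrder q β K T) atTop atTop := by
  have h1 : Tendsto (fun T : ℕ => (T : ℝ) ^ (1 - kappa q β)) atTop atTop :=
    (tendsto_rpow_atTop (sub_pos.2 hκ1)).comp tendsto_natCast_atTop_atTop
  refine tendsto_atTop_mono' _ ?_ h1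
  filter_upwards [eventually_ge_atTop 3] with T hT
  have hT' : (3 : ℝ) ≤ T := by exact_mod_cast hT
  have hT0 : (0 : ℝ) < T := by linarith
  have hlog : 1 ≤ Real.log T := by
    rw [Real.le_log_iff_exp_le hT0]
    linarith [Real.exp_one_lt_d9]
  have hK1 : 1 ≤ (K : ℝ) ^ (2 / q) :=
    Real.one_le_rpow (by exact_mod_cast Nat.one_le_iff_ne_zero.2 hK) (by positivity)
  rw [Real.rpow_sub hT0, Real.rpow_one, div_eq_mul_inv, ← Real.inv_rpow hT0.le, levelOrder]
  refine mul_le_mul_of_nonneg_left (Real.rpow_le_rpow (by positivity) ?_ hκ.le) hT0.le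
  have h2 : 1 / (T : ℝ) ≤ Real.log T / T := by gcongr
  rw [one_div] at h2
  exact h2.trans (le_mul_of_one_le_left (by positivity) hK1)

lemma mem_resolving_of_le {K : ℕ} {h : ℝ → ℝ} {F : Fin K → Measure ℝ} {L ρ ε c₀ : ℝ}
    (hq : 0 < q) (hL : 0 < L) (hρ : 0 < ρ) (hK : K ≠ 0) (hc₀ : 0 < c₀) (hε : 0 < ε) (hε2 : ε ≤ 2)
    (hgap : c₀ * ε ^ β ≤ minGap h F ε) {T : ℕ} (hTε : 3 ≤ T * ε / 2)
    (hlevel : 8 * 560 ^ 2 / ρ * (2 * L / c₀) ^ (2 / q) * ((K : ℝ) ^ (2 / q) * (Real.log T / T)) ≤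
      ε ^ (2 * β / q + 2)) {s : ℕ} (hs : T * ε / 2 ≤ s) :
    s ∈ resolving h F q L ρ ε := by
  have hK0 : (0 : ℝ) < K := by exact_mod_cast Nat.pos_of_ne_zero hK
  have hs3 : (3 : ℝ) ≤ s := hTε.trans hs
  have hs0 : (0 : ℝ) < s := by linarith
  have hT0 : (0 : ℝ) < T := by
    by_contra hneg
    have : (T : ℝ) * ε ≤ 0 := mul_nonpos_of_nonpos_of_nonneg (not_lt.1 hneg) hε.le
    linarith
  have he := Real.exp_one_lt_d9
  have hlog : 1 ≤ Real.log s := by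
    rw [Real.le_log_iff_exp_le hs0]
    linarith
  -- `35 = 3 + 32`, from `2e ≤ 9` and `log s ≥ 1`; together with the factor `16` of the radius it
  -- gives `560 = 16 * 35`.
  have hnum : √(2 * Real.exp 1 * Real.log s) + 32 ≤ 35 * √(Real.log s) := by
    have h1 : √(2 * Real.exp 1 * Real.log s) ≤ 3 * √(Real.log s) := by
      rw [Real.sqrt_mul (by positivity)]
      gcongr
      rw [Real.sqrt_le_left (by norm_num)]
      linarith
    have h2 : 1 ≤ √(Real.log s) := Real.one_le_sqrt.2 hlog
    linarith
  -- `log x / x` decreases beyond `e`, and `s ≥ T ε / 2 ≥ 3`. The factor `2` here and the `4` in `ρ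
  -- / 4` make up the `8` in `hlevel`.
  have hlogs : Real.log s / s ≤ 2 * (Real.log T / T) / ε := by
    have h1 : Real.log s / s ≤ Real.log (T * ε / 2) / (T * ε / 2) :=
      Real.log_div_self_antitoneOn (Set.mem_ofPred_eq ▸ he.le.trans (by linarith))
        (Set.mem_ofPred_eq ▸ he.le.trans (by linarith)) hs
    have h2 : Real.log (T * ε / 2) ≤ Real.log T :=
      Real.log_le_log (by linarith) (by nlinarith)
    calc Real.log s / s ≤ Real.log (T * ε / 2) / (T * ε / 2) := h1
      _ ≤ Real.log T / (T * ε / 2) := by gcongr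
      _ = 2 * (Real.log T / T) / ε := by
          field_simp
  set G : ℝ := c₀ * ε ^ β / (2 * K * L) with hG
  have hεβ : 0 < ε ^ β := Real.rpow_pos_of_pos hε _
  have hG0 : 0 < G := by positivity
  have hGsq : (G ^ (1 / q)) ^ 2 = (2 * L / c₀) ^ (-(2 / q)) * (K : ℝ) ^ (-(2 / q)) *
      ε ^ (2 * β / q) := by
    have h1 : (G ^ (1 / q)) ^ 2 = G ^ (2 / q) := by
      rw [← Real.rpow_natCast, ← Real.rpow_mul hG0.le]
      congr 1
      push_cast
      ring
    have h2 : G = (2 * L / c₀)⁻¹ * (K : ℝ)⁻¹ * ε ^ β := by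
      rw [hG]
      field_simp
    rw [h1, h2, Real.mul_rpow (by positivity) hεβ.le, Real.mul_rpow (by positivity) (by positivity),
      Real.inv_rpow (by positivity), Real.inv_rpow (by positivity), ← Real.rpow_neg (by positivity),
      ← Real.rpow_neg (by positivity), ← Real.rpow_mul hε.le]
    congr 2
    ring
  have hmain : 560 ^ 2 * (Real.log s / s) ≤ ρ / 4 * ε * (G ^ (1 / q)) ^ 2 := by
    have h1 : ε ^ (2 * β / q + 2) = ε ^ (2 * β / q) * ε ^ 2 := by
      rw [Real.rpow_add hε]
      norm_num
    rw [h1] at hlevel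
    have hLp : 0 < (2 * L / c₀) ^ (2 / q) := by positivity
    have hKp : 0 < (K : ℝ) ^ (2 / q) := by positivity
    rw [hGsq, Real.rpow_neg (by positivity), Real.rpow_neg (by positivity)]
    refine (mul_le_mul_of_nonneg_left hlogs (by norm_num)).trans ?_
    set l := Real.log T / T
    set a := (2 * L / c₀) ^ (2 / q)
    set k := (K : ℝ) ^ (2 / q)
    set e := ε ^ (2 * β / q)
    have h2 : 560 ^ 2 * (2 * l / ε) =
        ρ / (4 * ε * a * k) * (8 * 560 ^ 2 / ρ * a * (k * l)) := by
      field_simp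
      ring
    have h3 : ρ / 4 * ε * (a⁻¹ * k⁻¹ * e) = ρ / (4 * ε * a * k) * (e * ε ^ 2) := by
      field_simp
    rw [h2, h3]
    exact mul_le_mul_of_nonneg_left hlevel (by positivity)
  have hsqrt : 560 * √(Real.log s) ≤ √(ρ / 4 * s * ε) * G ^ (1 / q) := by
    have h1 : 0 ≤ Real.log s := by linarith
    have h2 : (560 * √(Real.log s)) ^ 2 ≤ (√(ρ / 4 * s * ε) * G ^ (1 / q)) ^ 2 := by
      rw [mul_pow, mul_pow, Real.sq_sqrt h1, Real.sq_sqrt (by positivity)]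
      have h3 := mul_le_mul_of_nonneg_right hmain hs0.le
      calc 560 ^ 2 * Real.log s = 560 ^ 2 * (Real.log s / s) * s := by field_simp
        _ ≤ ρ / 4 * ε * (G ^ (1 / q)) ^ 2 * s := h3
        _ = _ := by ring
    exact le_of_sq_le_sq h2 (by positivity)
  have hden : 0 < √(ρ / 4 * s * ε) := Real.sqrt_pos.2 (by positivity)
  have hGgap : G ^ (1 / q) ≤ (minGap h F ε / (2 * K * L)) ^ (1 / q) :=
    Real.rpow_le_rpow hG0.le (by rw [hG]; gcongr) (by positivity)
  simp only [resolving, Set.mem_ofPred_eq]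
  refine le_trans ?_ (mul_le_mul_of_nonneg_left hGgap (by norm_num))
  rw [div_le_iff₀ hden]
  linarith

/-- All `s ≥ T ε / 2` are resolving, so `T₀ ≤ ⌈T ε / 2⌉`. Hence `T₀ - 1 < T ε / 2`, which is `T(ε) <
T`. -/
lemma longHorizon_of_le {K : ℕ} {h : ℝ → ℝ} {F : Fin K → Measure ℝ} {L ρ ε c₀ : ℝ}
    (hq : 0 < q) (hL : 0 < L) (hρ : 0 < ρ) (hK : K ≠ 0) (hc₀ : 0 < c₀) (hε : 0 < ε) (hε2 : ε ≤ 2)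
    (hgap : c₀ * ε ^ β ≤ minGap h F ε) {T : ℕ} (hKT : Real.exp K < T) (hTε : 3 ≤ T * ε / 2)
    (hlevel : 8 * 560 ^ 2 / ρ * (2 * L / c₀) ^ (2 / q) * ((K : ℝ) ^ (2 / q) * (Real.log T / T)) ≤
      ε ^ (2 * β / q + 2)) :
    LongHorizon h F q L ρ ε T := by
  classical
  have hceil : 0 < ⌈T * ε / 2⌉₊ := Nat.ceil_pos.2 (by linarith)
  have hmem : ⌈T * ε / 2⌉₊ ∈
      {t : ℕ | 1 ≤ t ∧ ∀ s, t ≤ s → s ∈ resolving h F q L ρ ε} :=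
    ⟨hceil, fun s hs => mem_resolving_of_le hq hL hρ hK hc₀ hε hε2 hgap hTε hlevel
      (Nat.ceil_le.1 hs)⟩
  refine ⟨_, ⟨Nat.sInf_mem ⟨_, hmem⟩, fun t ht => Nat.sInf_le ht⟩, max_lt hKT ?_⟩
  have h1 : ((sInf {t : ℕ | 1 ≤ t ∧ ∀ s, t ≤ s → s ∈ resolving h F q L ρ ε} : ℕ) : ℝ) ≤
      ⌈T * ε / 2⌉₊ := by exact_mod_cast Nat.sInf_le hmem
  have h2 := Nat.ceil_lt_add_one (show 0 ≤ T * ε / 2 by linarith)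
  rw [div_mul_eq_mul_div, div_lt_iff₀ hε]
  linarith

lemma eventually_longHorizon {K : ℕ} {h : ℝ → ℝ} {F : Fin K → Measure ℝ} {L ρ c₀ : ℝ}
    (hq : 0 < q) (hr : 0 < r) (hrβ : r ≤ β + q / 2) (hL : 0 < L) (hρ : 0 < ρ) (hK : K ≠ 0)
    (hc₀ : 0 < c₀) (hgap : ∀ᶠ ε in 𝓝[>] (0 : ℝ), c₀ * ε ^ β ≤ minGap h F ε) (c₂ : ℝ) :
    ∀ᶠ T : ℕ in atTop, ∀ ε : ℝ,
      (8 * 560 ^ 2 / ρ * (2 * L / c₀) ^ (2 / q)) ^ kappa q β * levelOrder q β K T ≤ ε →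
      ε ≤ c₂ * levelOrder q β K T → LongHorizon h F q L ρ ε T := by
  have hκ := kappa_pos hq hr hrβ
  have hκ1 := kappa_lt_one hq hr hrβ
  set D : ℝ := 8 * 560 ^ 2 / ρ * (2 * L / c₀) ^ (2 / q) with hD
  have hD0 : 0 < D := by positivity
  have hDκ : 0 < D ^ kappa q β := Real.rpow_pos_of_pos hD0 _
  obtain ⟨δ, hδ0, hδ⟩ := mem_nhdsGT_iff_exists_Ioo_subset.1 hgap
  have hup := (tendsto_levelOrder hκ K).const_mul c₂
  rw [mul_zero] at hup
  have hlow := (tendsto_mul_levelOrder hq hκ hκ1 hK).const_mul_atTop hDκ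
  filter_upwards [hup.eventually_lt_const (Set.mem_Ioi.1 hδ0),
    hup.eventually_lt_const (show (0 : ℝ) < 2 by norm_num), hlow.eventually_ge_atTop 6,
    tendsto_natCast_atTop_atTop.eventually_gt_atTop (Real.exp K), eventually_ge_atTop 2]
    with T hTδ hT2 hT6 hTK hTtwo ε hε1 hε2
  have hT0 : (0 : ℝ) < T := (Real.exp_pos _).trans hTK
  have hx := levelOrder_pos (q := q) (β := β) hK hTtwo
  have hε0 : 0 < ε := (mul_pos hDκ hx).trans_le hε1
  refine longHorizon_of_le hq hL hρ hK hc₀ hε0 (hε2.trans hT2.le)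
    (hδ ⟨hε0, hε2.trans_lt hTδ⟩) hTK ?_ ?_
  · have h1 := mul_le_mul_of_nonneg_left hε1 hT0.le
    rw [mul_left_comm] at h1
    linarith
  · have hlog : 0 ≤ Real.log T / T :=
      div_nonneg (Real.log_nonneg (by exact_mod_cast (show 1 ≤ T by omega))) hT0.le
    have h1 : D ^ kappa q β * levelOrder q β K T =
        (D * ((K : ℝ) ^ (2 / q) * (Real.log T / T))) ^ kappa q β := by
      rw [levelOrder, Real.mul_rpow hD0.le (by positivity)]
    have h2 : 2 * β / q + 2 = (kappa q β)⁻¹ := by rw [kappa, inv_inv]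
    rw [h1] at hε1
    -- Raising the lower bound on `ε` to the power `1/κ = 2β/q + 2` gives the required inequality;
    -- this is why the constant is a `κ`-th power.
    have h3 := Real.rpow_le_rpow (by positivity) hε1 (inv_pos.2 hκ).le
    rw [Real.rpow_rpow_inv (by positivity) hκ.ne'] at h3
    rw [h2]
    exact h3

end Rates

end MixtureBandit

theorem theorem4 (q r β ρ B L W : ℝ) (hq : 0 < q) (hq1 : q ≤ 1) (hr : 0 < r)
    (hρ : 0 < ρ) (hρ1 : ρ < 1) (hB : 0 < B) (hL : 0 < L) (hrβ : r ≤ β + q / 2) :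
    -- the regret bound, for every choice `ε = Θ((K^{2/q} log T / T)^κ)`
    (∀ c₁ c₂ : ℝ, 0 < c₁ → c₁ ≤ c₂ → ∃ C : ℝ, 0 < C ∧
      ∀ (K : ℕ) (S : Set ℝ) (F : Fin K → MeasureTheory.Measure ℝ) (h : ℝ → ℝ) (α : Fin K → ℝ),
        MixtureBandit.IsInstance S F h α q r B L W →
        MixtureBandit.HasGapExponent h F β →
        ∀ (T : ℕ) (ε : ℝ),
          c₁ * MixtureBandit.levelOrder q β K T ≤ ε →
          ε ≤ c₂ * MixtureBandit.levelOrder q β K T →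
          MixtureBandit.LongHorizon h F q L ρ ε T →
          ∀ (X : Type*) [MeasurableSpace X] (P : MeasureTheory.Measure X)
            [MeasureTheory.IsProbabilityMeasure P]
            (Y : Fin K → ℕ → X → ℝ) (A : ℕ → X → Fin K) (a : ℕ → X → Fin K → ℝ),
            MixtureBandit.IsRewardTable P F Y →
            (MixtureBandit.FollowsUCB P ρ ε T (MixtureBandit.rsIndex S h T A Y) A a ∨
              MixtureBandit.FollowsUCB P ρ ε T (MixtureBandit.ceIndex h q L T A Y) A a) →
            MixtureBandit.regret P h F α A T ≤
              C * (K : ℝ) ^ MixtureBandit.cU q r β *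
                (Real.log T / T) ^ (r * MixtureBandit.kappa q β)) ∧
    -- the horizon condition holds for such choices of `ε` if `Δ_min(ε) = Ω(ε^β)`
    (∀ c₀ : ℝ, 0 < c₀ → ∃ c : ℝ, 0 < c ∧
      ∀ (K : ℕ) (S : Set ℝ) (F : Fin K → MeasureTheory.Measure ℝ) (h : ℝ → ℝ) (α : Fin K → ℝ),
        MixtureBandit.IsInstance S F h α q r B L W →
        MixtureBandit.HasGapExponent h F β →
        (∀ᶠ ε in 𝓝[>] (0 : ℝ), c₀ * ε ^ β ≤ MixtureBandit.minGap h F ε) →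
        ∀ c₂ : ℝ, ∀ᶠ T : ℕ in atTop, ∀ ε : ℝ,
          c * MixtureBandit.levelOrder q β K T ≤ ε →
          ε ≤ c₂ * MixtureBandit.levelOrder q β K T →
          MixtureBandit.LongHorizon h F q L ρ ε T) := by
  refine ⟨fun c₁ c₂ hc₁ hc₁₂ => ?_, fun c₀ hc₀ => ?_⟩
  · have hc₂ : 0 < c₂ := hc₁.trans_le hc₁₂
    -- The constant is chosen before any instance is given, and only an instance forces `W ≥ 0`;
    -- hence the absolute value.
    refine ⟨L * (4 * |W| * c₂) ^ r + L * (2 * |W|) ^ q + B, by positivity, ?_⟩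
    intro K S F h α hI _ T ε hε₁ hε₂ hT X _ P _ Y A a hY hrun
    have hK := hI.arms_ne_zero
    have hT2 : 2 ≤ T := by
      have h1 : Real.exp 0 < T :=
        (Real.exp_le_exp.2 (Nat.cast_nonneg K)).trans_lt hT.exp_lt
      rw [Real.exp_zero] at h1
      exact_mod_cast h1
    have hε : 0 < ε := (mul_pos hc₁ (MixtureBandit.levelOrder_pos hK hT2)).trans_le hε₁
    have hW := hI.ratio_nonneg
    rw [abs_of_nonneg hW]
    refine le_trans ?_ (MixtureBandit.rate_le hq hq1 hr hrβ hB hL hW hc₂ hK hT.exp_lt hε hε₂)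
    rcases hrun with hrun | hrun
    · exact hI.regret_le hq hq1 hr hB hL hρ hρ1 hε hT (Or.inl rfl) hY hrun
    · exact hI.regret_le hq hq1 hr hB hL hρ hρ1 hε hT (Or.inr rfl) hY hrun
  · have hκ := MixtureBandit.kappa_pos hq hr hrβ
    refine ⟨(8 * 560 ^ 2 / ρ * (2 * L / c₀) ^ (2 / q)) ^ MixtureBandit.kappa q β,
      by positivity, ?_⟩
    intro K S F h α hI _ hgap c₂
    exact MixtureBandit.eventually_longHorizon hq hr hrβ hL hρ hI.arms_ne_zero hc₀ hgap c₂
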